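/- Let $n\ge 1$. The nesting polyomino and the crossing polyomino have the same shape: $n$ columns of heights $2n-1,2n-2,\dots,n$ (from left to right) standing on a common base line. Write $(i,h)$ for the box in column $i$ (from the left) at height $h$ (from below), so $1\le i\le n$ and $1\le h\le 2n-i$. From top to bottom the rows are labelled $2,3,\dots,n,-n,\dots,-2,-1$ in the nesting polyomino and $2,3,\dots,n,-1,-2,\dots,-n$ in the crossing polyomino. An arbitrary filling is an assignment of non-negative integers to the boxes such that, in the square formed by the $n$ lowest rows, the boxes in column $i$, row $-j$ and in column $j$, row $-i$ have equal entries for all $i,j\in\{1,\dots,n\}$. That is, this square is symmetric in its north-east diagonal (the entries of $(i,h)$ and $(h,i)$ agree) for the nesting polyomino, and symmetric in its south-east diagonal (the entries of $(i,h)$ and $(n+1-h,n+1-i)$ agree) for the crossing polyomino. A filling labels the lattice points $(a,b)$ of the polyomino (corners of boxes; $(a,b)$ is the top-right corner of the box $(a,b)$) by integer partitions, as follows. All points $(0,b)$ and $(a,0)$ carry the empty partition. If a box has entry $m$ and its bottom-left, top-left and bottom-right corners carry $\rho,\mu,\nu$, then its top-right corner carries the partition $\lambda$ given by a local rule, where parts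 are indexed from $1$ and partitions are padded with zeros. * Nesting polyomino (Robinson-Schensted-Knuth rule): $\lambda_1=\max(\mu_1,\nu_1)+m$ and $\lambda_{i+1}=\max(\mu_{i+1},\nu_{i+1})+\min(\mu_i,\nu_i)-\rho_i$ for $i\ge1$. * Crossing polyomino (dual RSK$'$ rule): $\lambda_i=\max(\mu_i,\nu_i)+s_i$, where $s_i=\min(1,c_i)$ if $\rho_i=\mu_i=\nu_i$ and $s_i=0$ otherwise, with carries $c_1=m$ and $c_{i+1}=c_i-s_i+\min(\mu_i,\nu_i)-\rho_i$. The border of the upper half of the polyomino, read from top to bottom, carries the sequence of labels $(\lambda_0,\lambda_1,\dots,\lambda_{2n-1})$, where $\lambda_0=\emptyset$ labels the top-left corner $(0,2n-1)$ of the polyomino, $\lambda_{2k-1}$ ($1\le k\le n$) labels the top-right corner $(k,2n-k)$ of column $k$, and $\lambda_{2k}$ ($1\le k\le n-1$) labels the point $(k,2n-k-1)$ directly below it. A horizontal (vertical) strip is a set of added cells of a Young diagram no two of which lie in the same column (row). Proposition. (1) Sending a filling of the nesting polyomino to its sequence of border labels is a bijection from the set of arbitrary fillings of the nesting polyomino onto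 the set of all sequences of integer partitions $(\lambda_0=\emptyset,\lambda_1,\dots,\lambda_{2n-1})$ such that for all $k$ * $\lambda_{2k-1}=\lambda_{2k}$, or $\lambda_{2k-1}$ is obtained from $\lambda_{2k}$ by adding a horizontal strip, and * $\lambda_{2k+1}=\lambda_{2k}$, or $\lambda_{2k+1}$ is obtained from $\lambda_{2k}$ by adding a horizontal strip, whenever the indices lie in $\{0,\dots,2n-1\}$. (2) Sending a filling of the crossing polyomino to its sequence of border labels is a bijection from the set of arbitrary fillings of the crossing polyomino onto the set of all sequences of integer partitions $(\lambda_0=\emptyset,\lambda_1,\dots,\lambda_{2n-1})$ such that for all $k$ * $\lambda_{2k-1}=\lambda_{2k}$, or $\lambda_{2k-1}$ is obtained from $\lambda_{2k}$ by adding a vertical strip, and * $\lambda_{2k+1}=\lambda_{2k}$, or $\lambda_{2k+1}$ is obtained from $\lambda_{2k}$ by adding a vertical strip, whenever the indices lie in $\{0,\dots,2n-1\}$. -/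

import Mathlib

/-- The polyomino with `n` columns of heights `2n-1, 2n-2, …, n`, all standing on a common base line.
The cell `(i, h)` is the box in column `i` (counted from the left, starting with `1`) at height `h`
(counted from below, starting with `1`); column `i` has height `2n-i`.  The nesting and the crossing
polyomino both have this shape.  From bottom to top, the rows of the nesting polyomino are labelled
`-1, -2, …, -n, n, …, 3, 2`, those of the crossing polyomino `-n, …, -2, -1, n, …, 3, 2`. -/
def polyomino (n : ℕ) : Finset (ℕ × ℕ) :=
  (Finset.Icc 1 n ×ˢ Finset.Icc 1 (2 * n)).filter fun c => c.1 + c.2 ≤ 2 * n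

/-- Arbitrary fillings of the boxes with non-negative integers. -/
abbrev Filling (n : ℕ) : Type := {c : ℕ × ℕ // c ∈ polyomino n} → ℕ

/-- Symmetry of the `n` lowest rows (a square) in the diagonal that runs north-east from the
bottom-left box.  In the row labels of the nesting polyomino, the boxes `(i, -j)` and `(j, -i)`
have equal entries. -/
def IsNestingSymmetric {n : ℕ} (f : Filling n) : Prop :=
  ∀ c d : {c : ℕ × ℕ // c ∈ polyomino n},
    c.1.2 ≤ n → d.1.1 = c.1.2 → d.1.2 = c.1.1 → f d = f c

/-- Symmetry of the `n` lowest rows (a square) in the diagonal that runs south-east to the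
bottom-right box.  In the row labels of the crossing polyomino, the boxes `(i, -j)` and `(j, -i)`
have equal entries. -/
def IsCrossingSymmetric {n : ℕ} (f : Filling n) : Prop :=
  ∀ c d : {c : ℕ × ℕ // c ∈ polyomino n},
    c.1.2 ≤ n → d.1.1 + c.1.2 = n + 1 → d.1.2 + c.1.1 = n + 1 → f d = f c

/-- The entry in column `i` at height `h`, and `0` outside the polyomino. -/
def Filling.entry {n : ℕ} (f : Filling n) (i h : ℕ) : ℕ :=
  if hc : (i, h) ∈ polyomino n then f ⟨(i, h), hc⟩ else 0

/-! ### Local rules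

A partition is handled here through its sequence of parts, indexed from `0` and padded with zeros.
The corners of a box with entry `m` carry the partitions `ρ` (bottom-left), `μ` (top-left) and
`ν` (bottom-right); a local rule produces the partition in the top-right corner. -/

/-- The carry that reaches part `i` in the local rule of the Robinson-Schensted-Knuth
correspondence. -/
def rskCarry (ρ μ ν : ℕ → ℕ) (m : ℕ) : ℕ → ℕ
  | 0 => m
  | i + 1 => min (μ i) (ν i) - ρ i

/-- The local rule of the Robinson-Schensted-Knuth correspondence. -/
def rskRule (ρ μ ν : ℕ → ℕ) (m : ℕ) (i : ℕ) : ℕ :=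
  max (μ i) (ν i) + rskCarry ρ μ ν m i

/-- The amount added to part `i`, if the carry is `c`, in the local rule for vertical strips. -/
def dualStep (ρ μ ν : ℕ → ℕ) (i c : ℕ) : ℕ :=
  if ρ i = μ i ∧ μ i = ν i then min 1 c else 0

/-- The carry that reaches part `i` in the local rule for vertical strips. -/
def dualCarry (ρ μ ν : ℕ → ℕ) (m : ℕ) : ℕ → ℕ
  | 0 => m
  | i + 1 => dualCarry ρ μ ν m i - dualStep ρ μ ν i (dualCarry ρ μ ν m i)
      + (min (μ i) (ν i) - ρ i)

/-- The local rule for vertical strips (the dual RSK' correspondence). -/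
def dualRule (ρ μ ν : ℕ → ℕ) (m : ℕ) (i : ℕ) : ℕ :=
  max (μ i) (ν i) + dualStep ρ μ ν i (dualCarry ρ μ ν m i)

/-- The growth diagram of the entries `e` for a given local rule: `growth rule e a b` is the
partition at the lattice point `(a, b)`, the top-right corner of the box `(a, b)`.  The points on
the left and on the lower boundary carry the empty partition. -/
def growth (rule : (ℕ → ℕ) → (ℕ → ℕ) → (ℕ → ℕ) → ℕ → ℕ → ℕ) (e : ℕ → ℕ → ℕ) :
    ℕ → ℕ → ℕ → ℕ
  | 0, _ => fun _ => 0
  | _ + 1, 0 => fun _ => 0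
  | a + 1, b + 1 =>
      rule (growth rule e a b) (growth rule e a (b + 1)) (growth rule e (a + 1) b)
        (e (a + 1) (b + 1))
  termination_by a b => a + b

/-- The label of the `k`-th point of the border of the upper half, read from top to bottom, for
`k = 0, 1, …, 2n-1`.  Point `0` is the top-left corner of the polyomino, point `2k-1` is
the top-right corner `(k, 2n-k)` of column `k`, and point `2k` is `(k, 2n-k-1)`, one unit below
point `2k-1`. -/
def borderLabel (rule : (ℕ → ℕ) → (ℕ → ℕ) → (ℕ → ℕ) → ℕ → ℕ → ℕ) {n : ℕ} (f : Filling n)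
    (k : ℕ) : ℕ → ℕ :=
  growth rule f.entry ((k + 1) / 2) (2 * n - 1 - k / 2)

/-- `β` is obtained from `α` by adding a horizontal strip: no two added cells share a column. -/
def AddsHorizontalStrip (α β : YoungDiagram) : Prop :=
  α ≤ β ∧ ∀ c ∈ β.cells \ α.cells, ∀ d ∈ β.cells \ α.cells, c.2 = d.2 → c = d

/-- `β` is obtained from `α` by adding a vertical strip: no two added cells share a row. -/
def AddsVerticalStrip (α β : YoungDiagram) : Prop :=
  α ≤ β ∧ ∀ c ∈ β.cells \ α.cells, ∀ d ∈ β.cells \ α.cells, c.1 = d.1 → c = d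

/-- The sequences `∅ = s 0, s 1, …, s (2n-1)` of partitions in which `s (2k-1)` and `s (2k+1)` are
both equal to `s (2k)` or obtained from it by adding a strip of the given kind. -/
def IsStripSequence (adds : YoungDiagram → YoungDiagram → Prop) {n : ℕ}
    (s : Fin (2 * n) → YoungDiagram) : Prop :=
  (∀ a : Fin (2 * n), a.val = 0 → s a = ⊥) ∧
    ∀ a b : Fin (2 * n), Even a.val → (b.val + 1 = a.val ∨ b.val = a.val + 1) →
      s b = s a ∨ adds (s a) (s b)

/-! Both local rules are invertible (`isLocalRule_rskRule`, `isLocalRule_dualRule`): the top-left,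
bottom-right and top-right labels of a box determine its bottom-left label and its entry, and every
compatible triple of labels occurs. Hence the border labels determine, and freely prescribe,
everything above the square (`IsLocalRule.staircase_inj`, `IsLocalRule.staircase_surj`). It remains
to match the chains of labels on the top side of the square with the symmetric fillings of the
square.

For RSK the rule is symmetric in its two strips, so transposing the entries transposes the growth
diagram. A symmetric square thus has the same labels on its right side as on its top side, and these
two sides determine its entries. For existence, the border is reflected to that of a full staircase;
the filling obtained there is symmetric by uniqueness (`IsLocalRule.border_surj`).

For the dual rule, reversing the rows of the square turns south-east symmetry into north-east
symmetry. The crossing case reduces to the nesting case once the reversed square is known to carry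
the conjugate partitions on its top side (`areConjugate_growth`). To prove this, an RSK diagram is
built by adding rows from below. Consider the cube of labels whose three directions are a new column
on the right, a new row on top and a new row from below. Two opposite faces obey RSK, two obey jeu
de taquin, two obey the Burge step, that is, the dual rule on conjugates. The slide and Burge
conditions pass from the faces at the near corner to the opposite faces (`cube_slide`,
`cube_burgeStep`), so induction over columns and rows yields the Burge step everywhere
(`upperGrowth_below`), and `areConjugate_dualRule` translates it. -/

/-- One application of the local rule for vertical strips, read off from the conjugate
partitions; `c r` is the carry that enters row `r` from below. -/
structure BurgeStep (ρ μ ν l c : ℕ → ℕ) : Prop where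
  zero : l 0 = max (μ 0) (ν 0) + c 0
  succ : ∀ r, l (r + 1) =
    max (μ (r + 1)) (ν (r + 1)) + min (c (r + 1)) (ρ r - max (μ (r + 1)) (ν (r + 1)))
  carry : ∀ r, c r + min (c (r + 1)) (ρ r - max (μ (r + 1)) (ν (r + 1))) =
    c (r + 1) + (min (μ r) (ν r) - ρ r)

/-- The local rule of jeu de taquin. -/
structure IsSlide (ρ β γ τ : ℕ → ℕ) : Prop where
  zero : γ 0 + β 0 = τ 0 + max (τ 1) (ρ 0)
  succ : ∀ r, γ (r + 1) + β (r + 1) = min (τ (r + 1)) (ρ r) + max (τ (r + 2)) (ρ (r + 1))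

/-- The parts of `β` and `α` interlace, that is, `β / α` is a horizontal strip. -/
structure Interlaces (α β : ℕ → ℕ) : Prop where
  le : ∀ i, α i ≤ β i
  succ_le : ∀ i, β (i + 1) ≤ α i

/-! ### Arithmetic of one row of the cube -/

/-- Total of a part and of the carry out of it. -/
theorem row_top {y α0 γ0 ρ0 c0 r1 αγ0 : ℕ} (h1 : ρ0 ≤ α0) (h2 : ρ0 ≤ γ0) (h8 : α0 ≤ y) (h9 : γ0 ≤ y)
    (hαγ : αγ0 = max γ0 α0 + min c0 (y - max γ0 α0)) (hc : c0 = r1 + (min γ0 α0 - ρ0)) :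
    αγ0 = min (γ0 + (α0 - ρ0) + r1) y := by omega

/-- The RSK carry on the far face is the near carry enlarged by the rest `r1` of the Burge carry,
cut off where the new part would exceed `β0`. A non-zero rest forces `αγ1 = ρ0`, which is what
aligns the two maxima with `τ1`. -/
theorem bump_eq {y α0 γ0 ρ0 r1 αγ0 β0 τ0 τ1 αγ1 : ℕ} (h1 : ρ0 ≤ α0) (h3 : ρ0 ≤ β0) (h6 : τ1 ≤ β0)
    (hγ : γ0 + β0 = min τ0 y + max τ1 ρ0) (hαγ : αγ0 = min (γ0 + (α0 - ρ0) + r1) y)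
    (hle : αγ1 ≤ ρ0) (hr : r1 = 0 ∨ αγ1 = ρ0) :
    max τ1 αγ1 + (min τ0 αγ0 - γ0) = min (max τ1 αγ1 + (min β0 α0 - ρ0) + r1) β0 := by
  have hw : min τ0 αγ0 - γ0 = min (β0 - max τ1 ρ0) (α0 - ρ0 + r1) := by omega
  rw [hw]
  clear hw hγ hαγ
  omega

/-- The far slide condition in one row. Indices 1 and 2 belong to the row in question and the next
one, index 0 (and `ρ0`) to the row above; `u0` is the near RSK carry coming from above. -/
theorem slide_eq {p q z α1 β1 ρ0 ρ1 u0 r1 r2 σ1 σ2 αγ1 αγ2 τ1 τ2 α0 β0 : ℕ}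
    (hαγ : αγ1 = min (p + q - β1) ρ0) (hz : z = max τ2 ρ1) (hz' : z ≤ β1)
    (hq : q = z + (α1 - ρ1) + r2) (hp : p = min τ1 ρ0) (hβp : β1 ≤ p) (hρ : ρ1 ≤ α1)
    (hr1 : r1 = 0 ∨ αγ1 = ρ0) (hle2 : αγ2 ≤ ρ1) (hr2 : r2 = 0 ∨ αγ2 = ρ1)
    (hu : min β0 α0 = ρ0 + u0) (hρβ : ρ1 ≤ β1) (hα : α1 ≤ ρ0)
    (hσ1 : σ1 = min (max τ1 αγ1 + u0 + r1) β0)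
    (hσ2 : σ2 = min (max τ2 αγ2 + (min β1 α1 - ρ1) + r2) β1) :
    max β1 α1 + u0 + αγ1 = min σ1 α0 + max σ2 α1 := by
  -- Both terms containing `σ` collapse, after which only `p`, `q` and the near labels remain.
  have a1 : min σ1 α0 = u0 + max p αγ1 := by clear hσ2; omega
  have a2 : max σ2 α1 = max (min q β1) α1 := by clear hσ1 a1 hαγ; omega
  rw [a1, a2]
  clear hσ1 hσ2 a1 a2 hu hr1 hr2
  omega

/-- What remains of the carry after row `r + 1` has been filled. -/
def burgeRest (ρ μ ν c : ℕ → ℕ) (r : ℕ) : ℕ :=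
  c (r + 1) - min (c (r + 1)) (ρ r - max (μ (r + 1)) (ν (r + 1)))

/-- The carry in the opposite face of the cube. -/
def cubeCarry (α β γ τ αβ αγ c : ℕ → ℕ) (r : ℕ) : ℕ :=
  c r + min (τ r) (αβ r) + γ r + min (β r) (α r) - (β r + min (τ r) (αγ r) + min (γ r) (α r))

/-! ### The cube of local rules: from three faces to their opposites -/

section Cube

variable {ρ α β γ τ αβ αγ σ c : ℕ → ℕ} {m : ℕ}

theorem IsSlide.interlaces (hβ : Interlaces ρ β) (hτ : Interlaces β τ) (h : IsSlide ρ β γ τ) :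
    Interlaces ρ γ where
  le i := by
    have h1 := hτ.le i
    have h2 := hβ.succ_le
    rcases i with _ | i
    · have := h.zero; omega
    · have := h.succ i; have := h2 i; omega
  succ_le i := by
    have h1 := hτ.succ_le (i + 1)
    have h2 := hβ.le (i + 1)
    have := h.succ i
    simp only [add_assoc, Nat.reduceAdd] at h1
    omega

theorem BurgeStep.le_prev {μ ν l : ℕ → ℕ} (hμ : Interlaces ρ μ) (hν : Interlaces ρ ν)
    (h : BurgeStep ρ μ ν l c) (r : ℕ) : l (r + 1) ≤ ρ r := by
  have := h.succ r
  have := hμ.succ_le r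
  have := hν.succ_le r
  omega

/-- The carry moves past row `r + 1` only when that row is full, its capacity being the length `ρ r`
of the row above. -/
theorem BurgeStep.rest_eq_zero_or {μ ν l : ℕ → ℕ} (hμ : Interlaces ρ μ) (hν : Interlaces ρ ν)
    (h : BurgeStep ρ μ ν l c) (r : ℕ) : burgeRest ρ μ ν c r = 0 ∨ l (r + 1) = ρ r := by
  have := h.succ r
  have := hμ.succ_le r
  have := hν.succ_le r
  rw [burgeRest]
  omega

theorem BurgeStep.carry_eq {μ ν l : ℕ → ℕ} (h : BurgeStep ρ μ ν l c) (r : ℕ) :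
    c r = burgeRest ρ μ ν c r + (min (μ r) (ν r) - ρ r) := by
  have := h.carry r
  rw [burgeRest]
  omega

/-- Row `r` of the two steps, the row above being replaced by a bound `y` in the first row. -/
theorem exists_row_bound (hα : Interlaces ρ α) (hβ : Interlaces ρ β) (hτ : Interlaces β τ)
    (hS : IsSlide ρ β γ τ) (hG : BurgeStep ρ γ α αγ c) (r : ℕ) :
    ∃ y, β r ≤ y ∧ α r ≤ y ∧ γ r ≤ y ∧ (∀ s, r = s + 1 → y = ρ s) ∧
      (r = 0 → τ 0 ≤ y ∧ αγ 0 ≤ y) ∧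
      γ r + β r = min (τ r) y + max (τ (r + 1)) (ρ r) ∧
      αγ r = min (γ r + (α r - ρ r) + burgeRest ρ γ α c r) y := by
  have hγ := hS.interlaces hβ hτ
  rcases r with _ | r
  · have h0 := hG.zero
    have h1 := hS.zero
    -- The top row has no row above it; any bound that dominates all labels of this row serves in
    -- place of the missing `ρ` value.
    refine ⟨β 0 + α 0 + γ 0 + τ 0 + αγ 0, by omega, by omega, by omega, by simp, by omega,
      by rw [min_eq_left (by omega)]; exact h1,
      row_top (hα.le 0) (hγ.le 0) (by omega) (by omega) ?_ (hG.carry_eq 0)⟩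
    rw [min_eq_left (by omega)]
    exact h0
  · exact ⟨ρ r, hβ.succ_le r, hα.succ_le r, hγ.succ_le r, by simp, by simp, hS.succ r,
      row_top (hα.le _) (hγ.le _) (hα.succ_le r) (hγ.succ_le r) (hG.succ r) (hG.carry_eq _)⟩

variable (hα : Interlaces ρ α) (hβ : Interlaces ρ β) (hτ : Interlaces β τ)
  (hS : IsSlide ρ β γ τ) (hG : BurgeStep ρ γ α αγ c)
  (hαβ : ∀ i, αβ i = rskRule ρ β α m i) (hσ : ∀ i, σ i = rskRule γ τ αγ m i)

include hα hβ hτ hS hG hσ in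
-- Frees `σ` of the far RSK carry: it is expressed by the near RSK carry and the Burge rest. This
-- form feeds both conclusions about the cube.
theorem cube_row (r : ℕ) :
    σ (r + 1) = min (max (τ (r + 1)) (αγ (r + 1)) + (min (β r) (α r) - ρ r) +
      burgeRest ρ γ α c r) (β r) := by
  have hγ := hS.interlaces hβ hτ
  obtain ⟨y, -, -, -, -, -, h3, h4⟩ := exists_row_bound hα hβ hτ hS hG r
  rw [← bump_eq (hα.le r) (hβ.le r) (hτ.succ_le r) h3 h4 (hG.le_prev hγ hα r)
    (hG.rest_eq_zero_or hγ hα r), hσ]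
  rfl

include hα hβ hτ hS hG hαβ hσ in
theorem cube_slide : IsSlide α αβ αγ σ := by
  have hγ := hS.interlaces hβ hτ
  have key : ∀ r y, β r ≤ y → α r ≤ y → γ r ≤ y →
      γ r + β r = min (τ r) y + max (τ (r + 1)) (ρ r) →
      αγ r = min (γ r + (α r - ρ r) + burgeRest ρ γ α c r) y → ∀ u rr a b,
      (rr = 0 ∨ αγ r = y) → min b a = y + u →
      σ r = min (max (τ r) (αγ r) + u + rr) b →
      max (β r) (α r) + u + αγ r = min (σ r) a + max (σ (r + 1)) (α r) := by
    intro r y h1 h2 h3 h4 h5 u rr a b h6 h7 h8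
    have e1 := hα.le r
    have e2 := hβ.le r
    have e3 := hτ.le r
    have e4 := hτ.succ_le r
    -- The slide splits `γ r + β r` into `p` and `z`; adding the cells of `α / ρ` and the Burge rest
    -- to `z` gives `q`, so that `p + q - β r` is the untruncated value of `αγ r`.
    refine slide_eq (p := min (τ r) y) (q := max (τ (r + 1)) (ρ r) + (α r - ρ r) + burgeRest ρ γ α c r)
      (z := max (τ (r + 1)) (ρ r)) (ρ0 := y) (ρ1 := ρ r) (r1 := rr) (αγ2 := αγ (r + 1)) ?_ rfl ?_ rfl rfl ?_ e1 h6
      (hG.le_prev hγ hα r) (hG.rest_eq_zero_or hγ hα r) h7 e2 h2 h8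
      (cube_row hα hβ hτ hS hG hσ r)
    · rw [h5]; congr 1; omega
    · omega
    · omega
  constructor
  · obtain ⟨y, h1, h2, h3, -, h4, h5, h6⟩ := exists_row_bound hα hβ hτ hS hG 0
    have h4 := h4 rfl
    have h7 : σ 0 = max (τ 0) (αγ 0) + m := hσ 0
    -- The entry `m` acts as a bump from a virtual row above, of length `y` in `ρ` and `y + m` in
    -- `α` and `β`; no truncation is active there.
    have := key 0 y h1 h2 h3 h5 h6 m 0 (y + m) (y + m) (.inl rfl) (min_self _) (by omega)
    rw [hαβ 0]
    simp only [rskRule, rskCarry, Nat.zero_add, add_assoc] at this ⊢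
    omega
  · intro r
    obtain ⟨y, h1, h2, h3, h4, -, h5, h6⟩ := exists_row_bound hα hβ hτ hS hG (r + 1)
    obtain rfl := h4 r rfl
    have e1 := hα.le r
    have e2 := hβ.le r
    have := key (r + 1) _ h1 h2 h3 h5 h6 (min (β r) (α r) - ρ r) (burgeRest ρ γ α c r) (α r) (β r)
      (hG.rest_eq_zero_or hγ hα r) (by omega) (cube_row hα hβ hτ hS hG hσ r)
    rw [hαβ (r + 1)]
    simp only [rskRule, rskCarry, add_assoc, Nat.reduceAdd] at this ⊢
    omega

include hα hβ hτ hS hG hαβ hσ in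
theorem cube_burgeStep : BurgeStep β τ αβ σ (cubeCarry α β γ τ αβ αγ c) := by
  have hγ := hS.interlaces hβ hτ
  have f1 : ∀ r, αβ (r + 1) = max (β (r + 1)) (α (r + 1)) + (min (β r) (α r) - ρ r) := fun r => hαβ _
  have f2 : ∀ r, σ (r + 1) = max (τ (r + 1)) (αγ (r + 1)) + (min (τ r) (αγ r) - γ r) := fun r => hσ _
  have f3 : αβ 0 = max (β 0) (α 0) + m := hαβ _
  have f4 : σ 0 = max (τ 0) (αγ 0) + m := hσ _
  have hγτ : ∀ r, γ r ≤ τ r := by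
    intro r
    obtain ⟨y, h1, h2, -, -, -, h3, h4⟩ := exists_row_bound hα hβ hτ hS hG r
    have := hτ.succ_le r
    have := hβ.le r
    omega
  -- Balance of carries around the cube. The work lies in showing that the truncated subtractions,
  -- including the one in `cubeCarry`, are exact.
  have hC : ∀ r, cubeCarry α β γ τ αβ αγ c r + (min (τ r) (αγ r) - γ r) + (min (γ r) (α r) - ρ r) =
      c r + (min (τ r) (αβ r) - β r) + (min (β r) (α r) - ρ r) := by
    intro r
    obtain ⟨y, h1, h2, h3, -, -, h4, h5⟩ := exists_row_bound hα hβ hτ hS hG r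
    have e1 := hα.le r
    have e2 := hβ.le r
    have e3 := hτ.le r
    have e4 := hτ.succ_le r
    have e5 := hγ.le r
    have e6 := hG.carry_eq r
    have hw : min (τ r) (αγ r) - γ r =
        min (β r - max (τ (r + 1)) (ρ r)) (α r - ρ r + burgeRest ρ γ α c r) := by omega
    have h6 : γ r ≤ min (τ r) (αγ r) := by omega
    have h7 : β r ≤ αβ r := by
      rcases r with _ | r
      · omega
      · have := f1 r; omega
    have h8 : min (τ r) (αγ r) - γ r ≤ burgeRest ρ γ α c r + (min (β r) (α r) - ρ r) := by
      rw [hw]; clear hw h4 h5 h6; omega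
    have h9 : ρ r ≤ min (γ r) (α r) := le_min e5 e1
    have h10 : ρ r ≤ min (β r) (α r) := le_min e2 e1
    have h11 : β r ≤ min (τ r) (αβ r) := le_min e3 h7
    unfold cubeCarry
    clear hw h4 h5
    generalize min (τ r) (αγ r) = a at *
    generalize min (τ r) (αβ r) = b at *
    generalize min (β r) (α r) = d at *
    generalize min (γ r) (α r) = e at *
    omega
  -- The balance restated with maxima through `min + max = sum`; it turns `cube_row` into the Burge
  -- formula for row `r + 1`.
  have hV : ∀ r, max (τ (r + 1)) (αβ (r + 1)) + cubeCarry α β γ τ αβ αγ c (r + 1) =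
      max (τ (r + 1)) (αγ (r + 1)) + (min (β r) (α r) - ρ r) + burgeRest ρ γ α c r := by
    intro r
    have := hC (r + 1)
    have e1 := hα.le (r + 1)
    have e2 := hβ.le (r + 1)
    have e3 := hτ.le (r + 1)
    have e5 := hγ.le (r + 1)
    have g1 := min_add_max (τ (r + 1)) (αγ (r + 1))
    have g2 := min_add_max (τ (r + 1)) (αβ (r + 1))
    have g3 := min_add_max (β (r + 1)) (α (r + 1))
    have g4 := min_add_max (γ (r + 1)) (α (r + 1))
    have k1 := f1 r
    have k2 := hG.succ r
    have k3 : γ (r + 1) ≤ min (τ (r + 1)) (αγ (r + 1)) :=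
      le_min (hγτ _) (k2 ▸ (le_max_left _ _).trans (Nat.le_add_right _ _))
    have k4 : β (r + 1) ≤ min (τ (r + 1)) (αβ (r + 1)) :=
      le_min e3 (k1 ▸ (le_max_left _ _).trans (Nat.le_add_right _ _))
    have h9 : ρ (r + 1) ≤ min (γ (r + 1)) (α (r + 1)) := le_min e5 e1
    have h10 : ρ (r + 1) ≤ min (β (r + 1)) (α (r + 1)) := le_min e2 e1
    have h11 : min (c (r + 1)) (ρ r - max (γ (r + 1)) (α (r + 1))) ≤ c (r + 1) := min_le_left _ _
    unfold burgeRest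
    generalize min (c (r + 1)) (ρ r - max (γ (r + 1)) (α (r + 1))) = s at *
    generalize min (τ (r + 1)) (αγ (r + 1)) = a at *
    generalize min (τ (r + 1)) (αβ (r + 1)) = b at *
    generalize min (β (r + 1)) (α (r + 1)) = d at *
    generalize min (γ (r + 1)) (α (r + 1)) = e at *
    generalize min (β r) (α r) - ρ r = u at *
    generalize max (τ (r + 1)) (αγ (r + 1)) = x at *
    generalize max (τ (r + 1)) (αβ (r + 1)) = v at *
    generalize max (β (r + 1)) (α (r + 1)) = w at *
    generalize max (γ (r + 1)) (α (r + 1)) = z at *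
    omega
  have hV' : ∀ r, max (τ (r + 1)) (αβ (r + 1)) ≤ β r := by
    intro r
    have e1 := hα.succ_le r
    have e2 := hβ.succ_le r
    have e3 := hτ.succ_le r
    have e4 := hβ.le r
    have e5 := hα.le r
    have k1 := f1 r
    omega
  constructor
  · have := hC 0
    have e1 := hα.le 0
    have e2 := hβ.le 0
    have e3 := hτ.le 0
    have e5 := hγ.le 0
    have k2 := hG.zero
    have k4 := hγτ 0
    omega
  · intro r
    have h1 := hV r
    have h2 := hV' r
    rw [cube_row hα hβ hτ hS hG hσ r, ← h1]
    omega
  · intro r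
    have h1 := hV r
    have h2 := hV' r
    have h3 := cube_row hα hβ hτ hS hG hσ r
    have h4 := hC r
    have h5 := hG.carry_eq r
    have h6 := f2 r
    omega

end Cube

/-! ### Strips and local rules -/

/-- A partition, given by its parts padded with zeros. -/
structure IsPart (x : ℕ → ℕ) : Prop where
  anti : Antitone x
  zero : ∃ N, x N = 0

/-- The partition `β` is obtained from the partition `α` by adding a horizontal strip. -/
structure HStrip (α β : ℕ → ℕ) : Prop extends Interlaces α β where
  left : IsPart α
  right : IsPart β

/-- The partition `β` is obtained from the partition `α` by adding a vertical strip. -/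
structure VStrip (α β : ℕ → ℕ) : Prop where
  left : IsPart α
  right : IsPart β
  le : ∀ i, α i ≤ β i
  le_succ : ∀ i, β i ≤ α i + 1

/-- The invertible local rules that extend two strips `μ / ρ` and `ν / ρ` to a square. -/
structure IsLocalRule (R : (ℕ → ℕ) → (ℕ → ℕ) → (ℕ → ℕ) → ℕ → ℕ → ℕ)
    (V : (ℕ → ℕ) → (ℕ → ℕ) → Prop) : Prop where
  zero : V (fun _ => 0) (fun _ => 0)
  eq_zero : ∀ {α}, V α (fun _ => 0) → α = fun _ => 0
  symm : ∀ ρ μ ν m, R ρ μ ν m = R ρ ν μ m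
  strip : ∀ {ρ μ ν} m, V ρ μ → V ρ ν → V μ (R ρ μ ν m)
  inj : ∀ {ρ ρ' μ ν m m'}, V ρ μ → V ρ ν → V ρ' μ → V ρ' ν → R ρ μ ν m = R ρ' μ ν m' →
    ρ = ρ' ∧ m = m'
  surj : ∀ {μ ν l}, V μ l → V ν l → ∃ ρ m, V ρ μ ∧ V ρ ν ∧ R ρ μ ν m = l

theorem isPart_zero : IsPart fun _ => 0 := ⟨antitone_const, 0, rfl⟩

theorem IsPart.eq_zero {x : ℕ → ℕ} (h : IsPart x) : ∃ N, ∀ i, N ≤ i → x i = 0 := by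
  obtain ⟨N, hN⟩ := h.zero
  exact ⟨N, fun i hi => Nat.le_zero.1 (hN ▸ h.anti hi)⟩

theorem IsPart.of_le {x y : ℕ → ℕ} (h : IsPart x) (hle : ∀ i, y i ≤ x i)
    (hy : ∀ i, y (i + 1) ≤ y i) : IsPart y := by
  obtain ⟨N, hN⟩ := h.zero
  exact ⟨antitone_nat_of_succ_le hy, N, Nat.le_zero.1 (hN ▸ hle N)⟩

theorem rskRule_zero (ρ μ ν : ℕ → ℕ) (m : ℕ) : rskRule ρ μ ν m 0 = max (μ 0) (ν 0) + m := rfl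

theorem rskRule_succ (ρ μ ν : ℕ → ℕ) (m i : ℕ) :
    rskRule ρ μ ν m (i + 1) = max (μ (i + 1)) (ν (i + 1)) + (min (μ i) (ν i) - ρ i) := rfl

theorem rskRule_symm (ρ μ ν : ℕ → ℕ) (m : ℕ) : rskRule ρ μ ν m = rskRule ρ ν μ m := by
  funext i
  rcases i with _ | i
  · rw [rskRule_zero, rskRule_zero, max_comm]
  · rw [rskRule_succ, rskRule_succ, max_comm, min_comm]

theorem hStrip_rskRule {ρ μ ν : ℕ → ℕ} (m : ℕ) (hμ : HStrip ρ μ) (hν : HStrip ρ ν) :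
    HStrip μ (rskRule ρ μ ν m) := by
  have hI : Interlaces μ (rskRule ρ μ ν m) := by
    constructor
    · rintro (_ | i)
      · rw [rskRule_zero]; omega
      · rw [rskRule_succ]; omega
    · intro i
      have := hμ.succ_le i
      have := hν.succ_le i
      have := hν.le i
      have := hμ.le i
      rw [rskRule_succ]; omega
  refine ⟨hI, hμ.right, antitone_nat_of_succ_le fun i => (hI.succ_le i).trans (hI.le i), ?_⟩
  obtain ⟨N, hN⟩ := hμ.right.zero
  exact ⟨N + 1, Nat.le_zero.1 (hN ▸ hI.succ_le N)⟩

theorem isLocalRule_rskRule : IsLocalRule rskRule HStrip where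
  zero := ⟨⟨fun _ => le_rfl, fun _ => le_rfl⟩, isPart_zero, isPart_zero⟩
  eq_zero h := funext fun i => Nat.le_zero.1 (h.le i)
  symm := rskRule_symm
  strip := hStrip_rskRule
  inj := by
    intro ρ ρ' μ ν m m' h1 h2 h3 h4 h
    refine ⟨funext fun i => ?_, ?_⟩
    · have := congrFun h (i + 1)
      rw [rskRule_succ, rskRule_succ] at this
      have := h1.le i
      have := h2.le i
      have := h3.le i
      have := h4.le i
      omega
    · have := congrFun h 0
      rw [rskRule_zero, rskRule_zero] at this
      omega
  surj := by
    intro μ ν l h1 h2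
    -- Part `i + 1` of the rule solved for `ρ i`; interlacing with `l` makes the subtractions exact.
    set ρ : ℕ → ℕ := fun i => min (μ i) (ν i) - (l (i + 1) - max (μ (i + 1)) (ν (i + 1))) with hρ
    have hμ : Interlaces ρ μ := ⟨fun i => by simp only [hρ]; omega, fun i => by
      have := h1.succ_le i
      have := h2.succ_le i
      have := h1.le (i + 1)
      simp only [hρ]; omega⟩
    have hν : Interlaces ρ ν := ⟨fun i => by simp only [hρ]; omega, fun i => by
      have := h1.succ_le i
      have := h2.succ_le i
      have := h2.le (i + 1)
      simp only [hρ]; omega⟩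
    have hP : IsPart ρ := h1.left.of_le hμ.le fun i => (hμ.le _).trans (hμ.succ_le _)
    refine ⟨ρ, l 0 - max (μ 0) (ν 0), ⟨hμ, hP, h1.left⟩, ⟨hν, hP, h2.left⟩, ?_⟩
    funext i
    rcases i with _ | i
    · have := h1.le 0
      have := h2.le 0
      rw [rskRule_zero]; omega
    · have := h1.succ_le i
      have := h2.succ_le i
      have := h1.le (i + 1)
      have := h2.le (i + 1)
      rw [rskRule_succ]; simp only [hρ]; omega

/-! ### The rule for vertical strips -/

section Dual

variable {ρ μ ν l : ℕ → ℕ}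

theorem dualCarry_succ (ρ μ ν : ℕ → ℕ) (m i : ℕ) :
    dualCarry ρ μ ν m (i + 1) = dualCarry ρ μ ν m i - dualStep ρ μ ν i (dualCarry ρ μ ν m i)
      + (min (μ i) (ν i) - ρ i) := rfl

theorem dualRule_apply (ρ μ ν : ℕ → ℕ) (m i : ℕ) :
    dualRule ρ μ ν m i = max (μ i) (ν i) + dualStep ρ μ ν i (dualCarry ρ μ ν m i) := rfl

theorem dualStep_symm (ρ μ ν : ℕ → ℕ) (i c : ℕ) : dualStep ρ μ ν i c = dualStep ρ ν μ i c := by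
  unfold dualStep
  split_ifs <;> omega

theorem dualCarry_symm (ρ μ ν : ℕ → ℕ) (m i : ℕ) :
    dualCarry ρ μ ν m i = dualCarry ρ ν μ m i := by
  induction i with
  | zero => rfl
  | succ i ih => rw [dualCarry_succ, dualCarry_succ, ih, dualStep_symm, min_comm]

theorem dualRule_symm (ρ μ ν : ℕ → ℕ) (m : ℕ) : dualRule ρ μ ν m = dualRule ρ ν μ m := by
  funext i
  rw [dualRule_apply, dualRule_apply, dualCarry_symm, dualStep_symm, max_comm]

/-- Below the supports of the three partitions every part absorbs one unit, so the carry runs out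
after finitely many parts. -/
theorem dualCarry_eventually_zero (hρ : IsPart ρ) (hμ : IsPart μ) (hν : IsPart ν) (m : ℕ) :
    ∃ N, ∀ i, N ≤ i → dualCarry ρ μ ν m i = 0 ∧ ρ i = 0 ∧ μ i = 0 ∧ ν i = 0 := by
  obtain ⟨N₁, h1⟩ := hρ.eq_zero
  obtain ⟨N₂, h2⟩ := hμ.eq_zero
  obtain ⟨N₃, h3⟩ := hν.eq_zero
  set N := N₁ + N₂ + N₃
  have key : ∀ k, dualCarry ρ μ ν m (N + k) = dualCarry ρ μ ν m N - k := by
    intro k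
    induction k with
    | zero => rfl
    | succ k ih =>
      have e1 := h1 (N + k) (by omega)
      have e2 := h2 (N + k) (by omega)
      have e3 := h3 (N + k) (by omega)
      rw [← add_assoc, dualCarry_succ, ih, dualStep, e1, e2, e3, if_pos ⟨rfl, rfl⟩]
      omega
  refine ⟨N + dualCarry ρ μ ν m N, fun i hi =>
    ⟨?_, h1 i (by omega), h2 i (by omega), h3 i (by omega)⟩⟩
  obtain ⟨k, rfl⟩ := Nat.exists_eq_add_of_le hi
  rw [add_assoc, key]
  omega

theorem vStrip_dualRule (m : ℕ) (hμ : VStrip ρ μ) (hν : VStrip ρ ν) :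
    VStrip μ (dualRule ρ μ ν m) := by
  refine ⟨hμ.right, ⟨antitone_nat_of_succ_le fun i => ?_, ?_⟩, fun i => ?_, fun i => ?_⟩
  · have a1 := hμ.left.anti i.le_succ
    have a2 := hμ.right.anti i.le_succ
    have a3 := hν.right.anti i.le_succ
    have b1 := hμ.le i
    have b2 := hν.le i
    have b3 := hμ.le (i + 1)
    have b4 := hν.le (i + 1)
    rw [dualRule_apply, dualRule_apply, dualCarry_succ]
    simp only [Nat.succ_eq_add_one] at *
    generalize dualCarry ρ μ ν m i = d
    unfold dualStep
    split_ifs <;> omega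
  · obtain ⟨N, hN⟩ := dualCarry_eventually_zero hμ.left hμ.right hν.right m
    obtain ⟨h1, h2, h3, h4⟩ := hN N le_rfl
    exact ⟨N, by simp [dualRule_apply, dualStep, h1, h2, h3, h4]⟩
  · rw [dualRule_apply]; omega
  · have := hμ.le i
    have := hν.le_succ i
    rw [dualRule_apply]
    unfold dualStep
    split_ifs <;> omega

/-- The outgoing carry of a part, together with the new part, determines its incoming carry and `ρ
i`. Since both carries vanish far out, they agree all the way back to the entry. -/
theorem dual_inj {ρ' : ℕ → ℕ} {m m' : ℕ} (h1 : VStrip ρ μ) (h2 : VStrip ρ ν) (h3 : VStrip ρ' μ)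
    (h4 : VStrip ρ' ν) (h : dualRule ρ μ ν m = dualRule ρ' μ ν m') : ρ = ρ' ∧ m = m' := by
  have step : ∀ i, dualCarry ρ μ ν m (i + 1) = dualCarry ρ' μ ν m' (i + 1) →
      ρ i = ρ' i ∧ dualCarry ρ μ ν m i = dualCarry ρ' μ ν m' i := by
    intro i hi
    have a1 := h1.le i
    have a2 := h2.le i
    have a3 := h3.le i
    have a4 := h4.le i
    have b1 := h1.le_succ i
    have b2 := h2.le_succ i
    have b3 := h3.le_succ i
    have b4 := h4.le_succ i
    have := congrFun h i
    rw [dualRule_apply, dualRule_apply] at this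
    rw [dualCarry_succ, dualCarry_succ] at hi
    unfold dualStep at hi this
    split_ifs at hi this <;> omega
  obtain ⟨N, hN⟩ := dualCarry_eventually_zero h1.left h1.right h2.right m
  obtain ⟨N', hN'⟩ := dualCarry_eventually_zero h3.left h1.right h2.right m'
  have hc : ∀ k i, N + N' ≤ i + k → dualCarry ρ μ ν m i = dualCarry ρ' μ ν m' i := by
    intro k
    induction k with
    | zero => intro i hi; rw [(hN i (by omega)).1, (hN' i (by omega)).1]
    | succ k ih => intro i hi; exact (step i (ih (i + 1) (by omega))).2
  exact ⟨funext fun i => (step i (hc (N + N') _ (by omega))).1, hc (N + N') 0 (by omega)⟩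

theorem exists_backward_rec (g : ℕ → ℕ → ℕ) (I : ℕ) (hg : ∀ i, I ≤ i → g i 0 = 0) :
    ∃ d : ℕ → ℕ, (∀ i, I ≤ i → d i = 0) ∧ ∀ i, d i = g i (d (i + 1)) := by
  let D : ℕ → ℕ := fun k => Nat.rec 0 (fun k x => g (I - (k + 1)) x) k
  refine ⟨fun i => D (I - i), fun i hi => by simp only [Nat.sub_eq_zero_of_le hi]; rfl,
    fun i => ?_⟩
  rcases le_or_gt I i with h | h
  · simp only [Nat.sub_eq_zero_of_le h, Nat.sub_eq_zero_of_le (h.trans i.le_succ)]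
    exact (hg i h).symm
  · obtain ⟨k, hk⟩ : ∃ k, I - i = k + 1 := ⟨I - i - 1, by omega⟩
    have hk' : I - (i + 1) = k := by omega
    simp only [hk, hk']
    change g (I - (k + 1)) (D k) = g i (D k)
    congr
    omega

theorem dual_surj (h1 : VStrip μ l) (h2 : VStrip ν l) :
    ∃ ρ m, VStrip ρ μ ∧ VStrip ρ ν ∧ dualRule ρ μ ν m = l := by
  obtain ⟨I, hI⟩ := h1.right.eq_zero
  -- Carries reconstructed from the far end. A part that grew consumed one unit; an unchanged part
  -- with `μ i = ν i` and a positive outgoing carry must have produced one; if `μ i ≠ ν i` the carry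
  -- passes through unchanged.
  obtain ⟨d, hd0, hd⟩ := exists_backward_rec
    (fun i x => if max (μ i) (ν i) < l i then x + 1 else if μ i = ν i then x - 1 else x) I
    (fun i hi => by have := hI i hi; simp [this])
  -- A positive carry occurs only at non-zero parts of `l`, so the `μ i - 1` in the definition of
  -- `ρ` is a genuine predecessor.
  have hpos : ∀ k i, I ≤ i + k → 0 < d i → 0 < l i := by
    intro k
    induction k with
    | zero => intro i hi h; rw [hd0 i hi] at h; omega
    | succ k ih =>
      intro i hi h
      have h3 := hd i
      have h4 := ih (i + 1) (by omega)
      have h5 := h1.right.anti i.le_succ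
      simp only [Nat.succ_eq_add_one] at h5
      split_ifs at h3 <;> omega
  set ρ : ℕ → ℕ := fun i => if μ i = ν i ∧ l i = μ i ∧ 0 < d (i + 1) then μ i - 1
    else min (μ i) (ν i) with hρ
  have hρl : ∀ i, ρ i ≤ μ i ∧ μ i ≤ ρ i + 1 ∧ ρ i ≤ ν i ∧ ν i ≤ ρ i + 1 := by
    intro i
    have a1 := h1.le i
    have a2 := h2.le i
    have b1 := h1.le_succ i
    have b2 := h2.le_succ i
    simp only [hρ]
    split_ifs <;> omega
  have hP : IsPart ρ := by
    refine h1.left.of_le (fun i => (hρl i).1) fun i => ?_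
    have a1 := h1.le (i + 1)
    have a2 := h2.le (i + 1)
    have b1 := h1.right.anti i.le_succ
    have b2 := h1.left.anti i.le_succ
    have b3 := h2.left.anti i.le_succ
    have b4 := hd (i + 1)
    simp only [Nat.succ_eq_add_one] at *
    split_ifs at b4 <;> simp only [hρ] <;> split_ifs <;> omega
  have hstep : ∀ i, max (μ i) (ν i) + dualStep ρ μ ν i (d i) = l i ∧
      d i - dualStep ρ μ ν i (d i) + (min (μ i) (ν i) - ρ i) = d (i + 1) := by
    intro i
    have a1 := h1.le i
    have a2 := h2.le i
    have b1 := h1.le_succ i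
    have b2 := h2.le_succ i
    have b3 := hd i
    have b4 := hpos I (i + 1) (by omega)
    have b5 := h1.right.anti i.le_succ
    simp only [Nat.succ_eq_add_one] at b5
    unfold dualStep
    have b6 : ρ i = if μ i = ν i ∧ l i = μ i ∧ 0 < d (i + 1) then μ i - 1
      else min (μ i) (ν i) := rfl
    clear_value ρ
    split_ifs at b3 b6 ⊢ <;> omega
  have hcarry : ∀ i, dualCarry ρ μ ν (d 0) i = d i := by
    intro i
    induction i with
    | zero => rfl
    | succ i ih => rw [dualCarry_succ, ih, (hstep i).2]
  refine ⟨ρ, d 0, ⟨hP, h1.left, fun i => (hρl i).1, fun i => (hρl i).2.1⟩,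
    ⟨hP, h2.left, fun i => (hρl i).2.2.1, fun i => (hρl i).2.2.2⟩, ?_⟩
  funext i
  rw [dualRule_apply, hcarry, (hstep i).1]

theorem isLocalRule_dualRule : IsLocalRule dualRule VStrip where
  zero := ⟨isPart_zero, isPart_zero, fun _ => le_rfl, fun _ => Nat.le_succ _⟩
  eq_zero h := funext fun i => Nat.le_zero.1 (h.le i)
  symm := dualRule_symm
  strip := vStrip_dualRule
  inj := dual_inj
  surj := dual_surj

end Dual

/-! ### Growth diagrams -/

section Growth

variable {R : (ℕ → ℕ) → (ℕ → ℕ) → (ℕ → ℕ) → ℕ → ℕ → ℕ} {V : (ℕ → ℕ) → (ℕ → ℕ) → Prop}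

theorem growth_zero_left (R) (e : ℕ → ℕ → ℕ) (b : ℕ) : growth R e 0 b = fun _ => 0 := by
  rw [growth]

theorem growth_zero_right (R) (e : ℕ → ℕ → ℕ) (a : ℕ) : growth R e a 0 = fun _ => 0 := by
  cases a <;> rw [growth]

theorem growth_succ (R) (e : ℕ → ℕ → ℕ) (a b : ℕ) : growth R e (a + 1) (b + 1) =
    R (growth R e a b) (growth R e a (b + 1)) (growth R e (a + 1) b) (e (a + 1) (b + 1)) := by
  rw [growth]

theorem growth_congr {e e' : ℕ → ℕ → ℕ} {a b : ℕ}
    (h : ∀ i j, i < a → j < b → e (i + 1) (j + 1) = e' (i + 1) (j + 1)) :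
    growth R e a b = growth R e' a b := by
  induction a generalizing b with
  | zero => rw [growth_zero_left, growth_zero_left]
  | succ a iha =>
    induction b with
    | zero => rw [growth_zero_right, growth_zero_right]
    | succ b ihb =>
      rw [growth_succ, growth_succ, h a b a.lt_succ_self b.lt_succ_self,
        ihb fun i j hi hj => h i j hi (by omega), iha fun i j hi hj => h i j (by omega) (by omega),
        iha fun i j hi hj => h i j (by omega) (by omega)]

namespace IsLocalRule

variable (h : IsLocalRule R V)
include h

theorem growth_transpose {e e' : ℕ → ℕ → ℕ} {a b : ℕ}
    (he : ∀ i j, i < a → j < b → e (i + 1) (j + 1) = e' (j + 1) (i + 1)) :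
    growth R e a b = growth R e' b a := by
  induction a generalizing b with
  | zero => rw [growth_zero_left, growth_zero_right]
  | succ a iha =>
    induction b with
    | zero => rw [growth_zero_right, growth_zero_left]
    | succ b ihb =>
      rw [growth_succ, growth_succ, he a b a.lt_succ_self b.lt_succ_self, h.symm,
        ihb fun i j hi hj => he i j hi (by omega),
        iha fun i j hi hj => he i j (by omega) (by omega),
        iha fun i j hi hj => he i j (by omega) (by omega)]

theorem strip' {ρ μ ν : ℕ → ℕ} (m : ℕ) (hμ : V ρ μ) (hν : V ρ ν) : V ν (R ρ μ ν m) := by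
  rw [h.symm]
  exact h.strip m hν hμ

theorem growth_strip (e : ℕ → ℕ → ℕ) (a b : ℕ) :
    V (growth R e a b) (growth R e (a + 1) b) ∧ V (growth R e a b) (growth R e a (b + 1)) := by
  obtain ⟨s, hs⟩ : ∃ s, a + b = s := ⟨_, rfl⟩
  induction s generalizing a b with
  | zero =>
    obtain ⟨rfl, rfl⟩ : a = 0 ∧ b = 0 := by omega
    simp only [growth_zero_left, growth_zero_right]
    exact ⟨h.zero, h.zero⟩
  | succ s ih =>
    constructor
    · rcases b with _ | b
      · simp only [growth_zero_right]
        exact h.zero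
      · obtain ⟨h1, h2⟩ := ih a b (by omega)
        rw [growth_succ]
        exact h.strip _ h2 h1
    · rcases a with _ | a
      · simp only [growth_zero_left]
        exact h.zero
      · obtain ⟨h1, h2⟩ := ih a b (by omega)
        rw [growth_succ]
        exact h.strip' _ h2 h1

theorem growth_right (e : ℕ → ℕ → ℕ) (a b : ℕ) :
    V (growth R e a b) (growth R e (a + 1) b) := (h.growth_strip e a b).1

theorem growth_up (e : ℕ → ℕ → ℕ) (a b : ℕ) :
    V (growth R e a b) (growth R e a (b + 1)) := (h.growth_strip e a b).2

theorem growth_inj {e e' : ℕ → ℕ → ℕ} {a b : ℕ}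
    (h1 : growth R e (a + 1) b = growth R e' (a + 1) b)
    (h2 : growth R e a (b + 1) = growth R e' a (b + 1))
    (h3 : growth R e (a + 1) (b + 1) = growth R e' (a + 1) (b + 1)) :
    growth R e a b = growth R e' a b ∧ e (a + 1) (b + 1) = e' (a + 1) (b + 1) := by
  rw [growth_succ, growth_succ, ← h1, ← h2] at h3
  refine h.inj (h.growth_up e a b) (h.growth_right e a b) ?_ ?_ h3
  · rw [h2]; exact h.growth_up e' a b
  · rw [h1]; exact h.growth_right e' a b

/-- Two adjacent antidiagonals of labels are peeled off by inverting boxes. Inversion never moves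
below the lower row of a box, so the argument may be confined to the rows `b ≥ l`. -/
theorem staircase_inj {e e' : ℕ → ℕ → ℕ} {l N : ℕ}
    (hb : ∀ a b, l ≤ b → a + b = N ∨ a + b = N + 1 → growth R e a b = growth R e' a b) :
    ∀ a b, l ≤ b → a + b ≤ N + 1 → growth R e a b = growth R e' a b ∧
      (a + b < N → e (a + 1) (b + 1) = e' (a + 1) (b + 1)) := by
  have key : ∀ k a b, l ≤ b → a + b ≤ N + 1 → N ≤ a + b + k →
      growth R e a b = growth R e' a b := by
    intro k
    induction k with
    | zero => intro a b h1 h2 h3; exact hb a b h1 (by omega)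
    | succ k ih =>
      intro a b h1 h2 h3
      rcases le_or_gt N (a + b) with h4 | h4
      · exact hb a b h1 (by omega)
      · exact (h.growth_inj (ih (a + 1) b h1 (by omega) (by omega))
          (ih a (b + 1) (by omega) (by omega) (by omega))
          (ih (a + 1) (b + 1) (by omega) (by omega) (by omega))).1
  refine fun a b h1 h2 => ⟨key N a b h1 h2 (by omega), fun h3 => ?_⟩
  exact (h.growth_inj (key N (a + 1) b h1 (by omega) (by omega))
    (key N a (b + 1) (by omega) (by omega) (by omega))
    (key N (a + 1) (b + 1) (by omega) (by omega) (by omega))).2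

theorem square_inj {e e' : ℕ → ℕ → ℕ} {n : ℕ}
    (h1 : ∀ a, a ≤ n → growth R e a n = growth R e' a n)
    (h2 : ∀ b, b ≤ n → growth R e n b = growth R e' n b) :
    ∀ a b, a < n → b < n → e (a + 1) (b + 1) = e' (a + 1) (b + 1) := by
  have key : ∀ k a b, a ≤ n → b ≤ n → 2 * n ≤ a + b + k →
      growth R e a b = growth R e' a b := by
    intro k
    induction k with
    | zero =>
      intro a b ha hb hk
      obtain ⟨rfl, rfl⟩ : a = n ∧ b = n := by omega
      exact h1 _ le_rfl
    | succ k ih =>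
      intro a b ha hb hk
      rcases ha.eq_or_lt with rfl | ha
      · exact h2 b hb
      rcases hb.eq_or_lt with rfl | hb
      · exact h1 a ha.le
      exact (h.growth_inj (ih (a + 1) b (by omega) (by omega) (by omega))
        (ih a (b + 1) (by omega) (by omega) (by omega))
        (ih (a + 1) (b + 1) (by omega) (by omega) (by omega))).1
  intro a b ha hb
  exact (h.growth_inj (key (2 * n) (a + 1) b (by omega) (by omega) (by omega))
    (key (2 * n) a (b + 1) (by omega) (by omega) (by omega))
    (key (2 * n) (a + 1) (b + 1) (by omega) (by omega) (by omega))).2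

/-- Every labelling of the border of a staircase by strips comes from a growth diagram. -/
theorem staircase_surj (N : ℕ) (t : ℕ → ℕ → ℕ → ℕ)
    (h0 : ∀ b, t 0 b = fun _ => 0) (h0' : ∀ a, t a 0 = fun _ => 0)
    (ht : ∀ a b, a + b = N → V (t a b) (t (a + 1) b) ∧ V (t a b) (t a (b + 1))) :
    ∃ e, ∀ a b, a + b = N ∨ a + b = N + 1 → growth R e a b = t a b := by
  induction N generalizing t with
  | zero =>
    refine ⟨0, fun a b hab => ?_⟩
    rcases a with _ | a
    · rw [growth_zero_left, h0]
    · obtain rfl : b = 0 := by omega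
      rw [growth_zero_right, h0']
  | succ N ih =>
    have hback : ∀ a b, ∃ ρ m, a + b = N →
        V ρ (t a (b + 1)) ∧ V ρ (t (a + 1) b) ∧
          R ρ (t a (b + 1)) (t (a + 1) b) m = t (a + 1) (b + 1) := by
      intro a b
      by_cases hab : a + b = N
      · obtain ⟨ρ, m, h1⟩ := h.surj (ht a (b + 1) (by omega)).1 (ht (a + 1) b (by omega)).2
        exact ⟨ρ, m, fun _ => h1⟩
      · exact ⟨0, 0, fun h => absurd h hab⟩
    choose ρ m hρ using hback
    have e1 : ∀ a b, a + b = N → (if a + b = N then ρ a b else t a b) = ρ a b :=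
      fun a b hab => if_pos hab
    have e2 : ∀ a b, a + b = N + 1 → (if a + b = N then ρ a b else t a b) = t a b :=
      fun a b hab => if_neg (by omega)
    have g0 : ∀ b, (if 0 + b = N then ρ 0 b else t 0 b) = fun _ => 0 := by
      intro b
      split_ifs with hb
      · exact h.eq_zero (h0 (b + 1) ▸ (hρ 0 b hb).1)
      · exact h0 b
    have g0' : ∀ a, (if a + 0 = N then ρ a 0 else t a 0) = fun _ => 0 := by
      intro a
      split_ifs with ha
      · exact h.eq_zero (h0' (a + 1) ▸ (hρ a 0 ha).2.1)
      · exact h0' a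
    obtain ⟨e, he⟩ := ih (fun a b => if a + b = N then ρ a b else t a b) g0 g0' (by
      intro a b hab
      rw [e1 a b hab, e2 (a + 1) b (by omega), e2 a (b + 1) (by omega)]
      exact ⟨(hρ a b hab).2.1, (hρ a b hab).1⟩)
    have hlow : ∀ a b, a + b ≤ N + 1 → growth R (fun i j => if i + j = N + 2 then
        m (i - 1) (j - 1) else e i j) a b = growth R e a b := by
      intro a b hab
      refine growth_congr fun i j hi hj => if_neg (by omega)
    -- Only the outermost antidiagonal of entries is new. The inner labels do not see it and come
    -- from the induction hypothesis.
    refine ⟨fun i j => if i + j = N + 2 then m (i - 1) (j - 1) else e i j, fun a b hab => ?_⟩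
    rcases hab with hab | hab
    · rw [hlow a b (by omega), he a b (.inr hab), e2 a b hab]
    · rcases a with _ | a
      · rw [growth_zero_left, h0]
      rcases b with _ | b
      · rw [growth_zero_right, h0']
      have hab' : a + b = N := by omega
      rw [growth_succ, hlow a b (by omega), hlow a (b + 1) (by omega),
        hlow (a + 1) b (by omega), he a b (.inl hab'), he a (b + 1) (.inr (by omega)),
        he (a + 1) b (.inr (by omega)), e1 a b hab', e2 a _ (by omega), e2 _ b (by omega),
        if_pos (by omega)]
      exact (hρ a b hab').2.2

/-- The symmetric growth diagram on a staircase with given labels on the upper half of its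
border. -/
theorem border_surj {n : ℕ} (s : ℕ → ℕ → ℕ) (h0 : s 0 = fun _ => 0)
    (hs : ∀ k, k < n → V (s (2 * k)) (s (2 * k + 1)))
    (hs' : ∀ k, k + 1 < n → V (s (2 * k + 2)) (s (2 * k + 1))) :
    ∃ e : ℕ → ℕ → ℕ, (∀ i j, i + j + 2 ≤ 2 * n → e (i + 1) (j + 1) = e (j + 1) (i + 1)) ∧
      ∀ k, k < 2 * n → growth R e ((k + 1) / 2) (2 * n - 1 - k / 2) = s k := by
  rcases Nat.eq_zero_or_pos n with rfl | hn
  · exact ⟨0, fun _ _ _ => rfl, fun k hk => absurd hk (by omega)⟩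
  -- The upper half of the border is reflected in the diagonal. At the two ends, `2 * 0 - 1`
  -- truncates to `0` and yields the empty label.
  set t : ℕ → ℕ → ℕ → ℕ := fun a b =>
    s (if a + b = 2 * n then 2 * min a b - 1 else 2 * min a b) with ht
  have ht_symm : ∀ a b, t a b = t b a := fun a b => by simp only [ht, add_comm a b, min_comm a b]
  have t1 : ∀ a b, a + b = 2 * n → t a b = s (2 * min a b - 1) := fun a b hab => by
    simp only [ht, if_pos hab]
  have t2 : ∀ a b, a + b = 2 * n - 1 → t a b = s (2 * min a b) := fun a b hab => by
    simp only [ht]; rw [if_neg (by omega)]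
  have key : ∀ a b, a + b = 2 * n - 1 → V (t a b) (t (a + 1) b) := by
    intro a b hab
    rw [t2 a b hab, t1 (a + 1) b (by omega)]
    rcases lt_or_ge a b with hlt | hge
    · rw [min_eq_left hlt.le, min_eq_left hlt]
      exact hs a (by omega)
    · rw [min_eq_right hge, min_eq_right (hge.trans a.le_succ)]
      rcases b with _ | b
      · simp only [h0, Nat.mul_zero, Nat.zero_sub]
        exact h.zero
      · exact hs' b (by omega)
  obtain ⟨e, he⟩ := h.staircase_surj (2 * n - 1) t (fun b => by simp [ht, h0])
    (fun a => by simp [ht, h0]) fun a b hab => ⟨key a b hab, by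
      rw [ht_symm a b, ht_symm a (b + 1)]; exact key b a (by omega)⟩
  refine ⟨e, fun i j hij => ?_, fun k hk => ?_⟩
  -- The transposed entries have the same border labels, so uniqueness makes the entries symmetric.
  · refine (h.staircase_inj (e := e) (e' := fun i j => e j i) (l := 0) (N := 2 * n - 1)
      (fun a b _ hab => ?_) i j (Nat.zero_le _) (by omega)).2 (by omega)
    rw [h.growth_transpose (e := fun i j => e j i) (e' := e) fun _ _ _ _ => rfl, he a b hab,
      he b a (by omega), ht_symm]
  · rw [he _ _ (by omega)]
    obtain ⟨j, rfl | rfl⟩ := k.even_or_odd'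
    · rw [t2 _ _ (by omega)]
      congr 1
      omega
    · rw [t1 _ _ (by omega)]
      congr 1
      omega

end IsLocalRule

end Growth

/-! ### Conjugate partitions and the rule for vertical strips -/

/-- The partitions `x` and `y` are conjugate to each other. -/
def AreConjugate (x y : ℕ → ℕ) : Prop := ∀ i r, r < x i ↔ i < y r

namespace AreConjugate

variable {x y y' : ℕ → ℕ}

theorem symm (h : AreConjugate x y) : AreConjugate y x := fun i r => (h r i).symm

theorem right_unique (h : AreConjugate x y) (h' : AreConjugate x y') : y = y' :=
  funext fun r => eq_of_forall_lt_iff fun i => (h i r).symm.trans (h' i r)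

theorem left_unique {x' : ℕ → ℕ} (h : AreConjugate x y) (h' : AreConjugate x' y) : x = x' :=
  h.symm.right_unique h'.symm

theorem apply_eq (h : AreConjugate x y) {i k : ℕ} (h1 : ∀ r, r + 1 = k → i < y r) (h2 : y k ≤ i) :
    x i = k := by
  have a := h i k
  rcases k with _ | k
  · omega
  · have b := h i k
    have c := h1 k rfl
    omega

theorem isPart (h : AreConjugate x y) : IsPart x := by
  refine ⟨fun i j hij => ?_, y 0, ?_⟩
  · by_contra! hlt
    have := (h j _).1 hlt
    exact lt_irrefl _ ((h i _).2 (hij.trans_lt this))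
  · have := h (y 0) 0
    omega

theorem hStrip {x₁ y₁ : ℕ → ℕ} (h : AreConjugate x y) (h₁ : AreConjugate x₁ y₁) (hs : VStrip x x₁) :
    HStrip y y₁ := by
  refine ⟨⟨fun r => ?_, fun r => ?_⟩, h.symm.isPart, h₁.symm.isPart⟩
  · by_contra! hlt
    have h2 := (h _ r).2 hlt
    exact lt_irrefl _ ((h₁ _ r).1 (h2.trans_le (hs.le _)))
  · by_contra! hlt
    have h2 := (h₁ _ _).2 hlt
    have h3 := hs.le_succ (y r)
    exact lt_irrefl _ ((h (y r) r).1 (by omega))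

end AreConjugate

theorem IsPart.exists_areConjugate {x : ℕ → ℕ} (hx : IsPart x) : ∃ y, AreConjugate x y := by
  have hex : ∀ r, ∃ i, x i ≤ r := fun r => by
    obtain ⟨N, hN⟩ := hx.zero
    exact ⟨N, by omega⟩
  classical
  refine ⟨fun r => Nat.find (hex r), fun i r => ⟨fun h => ?_, fun h => ?_⟩⟩
  · by_contra! hle
    exact absurd ((hx.anti hle).trans (Nat.find_spec (hex r))) (by omega)
  · have := Nat.find_min (hex r) h
    omega

section DualBurge

variable {ρ μ ν ρ' μ' ν' l c : ℕ → ℕ} {m R : ℕ}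
  (hρ : AreConjugate ρ' ρ) (hμ : AreConjugate μ' μ) (hν : AreConjugate ν' ν)
  (hρμ : Interlaces ρ μ) (hρν : Interlaces ρ ν)
include hρ hμ hν hρμ hρν

/-- Part `i` of the conjugates is column `i`. Going right from row `r + 1` to row `r`, there are
first the columns in which row `r + 1` can take a cell, then those where `μ` and `ν` both extend `ρ`
in row `r`, then those where only one does. -/
theorem conj_addable {r i : ℕ} (h1 : max (μ (r + 1)) (ν (r + 1)) ≤ i) (h2 : i < ρ r) :
    ρ' i = r + 1 ∧ μ' i = r + 1 ∧ ν' i = r + 1 := by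
  have e1 := hρμ.le r
  have e2 := hρν.le r
  have e3 := hρμ.le (r + 1)
  refine ⟨hρ.apply_eq ?_ (by omega), hμ.apply_eq ?_ (by omega), hν.apply_eq ?_ (by omega)⟩ <;>
  · intro s hs
    obtain rfl : s = r := by omega
    omega

omit hμ hν in
theorem conj_base {r i : ℕ} (h1 : ρ r ≤ i) (h2 : i < max (μ r) (ν r)) : ρ' i = r := by
  refine hρ.apply_eq (fun s hs => ?_) h1
  subst hs
  have e1 := hρμ.succ_le s
  have e2 := hρν.succ_le s
  omega

omit hρ hν hρν in
theorem conj_left {r i : ℕ} (h1 : ρ r ≤ i) (h2 : i < μ r) : μ' i = r + 1 := by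
  refine hμ.apply_eq (fun s hs => ?_) ((hρμ.succ_le r).trans h1)
  obtain rfl : s = r := by omega
  exact h2

omit hρ hν in
theorem conj_not_left {r i : ℕ} (h1 : μ r ≤ i) (h2 : i < ν r) : μ' i = r := by
  refine hμ.apply_eq (fun s hs => ?_) h1
  subst hs
  exact h2.trans_le ((hρν.succ_le s).trans (hρμ.le s))

theorem dualCarry_addable {r : ℕ}
    (hd : dualCarry ρ' μ' ν' m (max (μ (r + 1)) (ν (r + 1))) = c (r + 1)) {i : ℕ}
    (h1 : max (μ (r + 1)) (ν (r + 1)) ≤ i) (h2 : i ≤ ρ r) :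
    dualCarry ρ' μ' ν' m i = c (r + 1) - (i - max (μ (r + 1)) (ν (r + 1))) := by
  induction i, h1 using Nat.le_induction with
  | base => rw [hd]; omega
  | succ i hi ih =>
    obtain ⟨e1, e2, e3⟩ := conj_addable hρ hμ hν hρμ hρν hi h2
    rw [dualCarry_succ, ih (by omega), dualStep, e1, e2, e3, if_pos ⟨rfl, rfl⟩]
    omega

/-- Over the three ranges of columns the carry drops by one per added cell, rises by one per column
common to `μ / ρ` and `ν / ρ`, and stays constant: this is the field `carry` of `BurgeStep`. -/
theorem dualCarry_max {r : ℕ} (hl : BurgeStep ρ μ ν l c)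
    (hd : dualCarry ρ' μ' ν' m (max (μ (r + 1)) (ν (r + 1))) = c (r + 1)) :
    dualCarry ρ' μ' ν' m (max (μ r) (ν r)) = c r := by
  have e1 := hρμ.le r
  have e2 := hρν.le r
  have e3 := hρμ.succ_le r
  have e4 := hρν.succ_le r
  have s1 := dualCarry_addable hρ hμ hν hρμ hρν hd (i := ρ r) (by omega) le_rfl
  have s2 : ∀ i, ρ r ≤ i → i ≤ min (μ r) (ν r) →
      dualCarry ρ' μ' ν' m i = dualCarry ρ' μ' ν' m (ρ r) + (i - ρ r) := by
    intro i hi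
    induction i, hi using Nat.le_induction with
    | base => intro _; omega
    | succ i hi ih =>
      intro h
      rw [dualCarry_succ, ih (by omega), dualStep,
        conj_base hρ hρμ hρν hi (by omega), conj_left hμ hρμ hi (by omega),
        conj_left hν hρν hi (by omega), if_neg (by omega)]
      omega
  have s3 : ∀ i, min (μ r) (ν r) ≤ i → i ≤ max (μ r) (ν r) →
      dualCarry ρ' μ' ν' m i = dualCarry ρ' μ' ν' m (min (μ r) (ν r)) := by
    intro i hi
    induction i, hi using Nat.le_induction with
    | base => intro _; rfl
    | succ i hi ih =>
      intro h
      rw [dualCarry_succ, ih (by omega), dualStep,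
        conj_base hρ hρμ hρν (i := i) (r := r) (by omega) (by omega)]
      rcases le_total (μ r) (ν r) with hle | hle
      · rw [conj_not_left hμ hρμ hρν (i := i) (r := r) (by omega) (by omega),
          conj_left hν hρν (i := i) (r := r) (by omega) (by omega), if_neg (by omega)]
        omega
      · rw [conj_not_left hν hρν hρμ (i := i) (r := r) (by omega) (by omega),
          conj_left hμ hρμ (i := i) (r := r) (by omega) (by omega), if_neg (by omega)]
        omega
  rw [s3 _ (by omega) le_rfl, s2 _ (by omega) le_rfl, s1]
  have := hl.carry r
  omega

theorem dualCarry_max_eq (hl : BurgeStep ρ μ ν l c)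
    (hR : ∀ r, R ≤ r → c r = m ∧ μ r = 0 ∧ ν r = 0) (r : ℕ) :
    dualCarry ρ' μ' ν' m (max (μ r) (ν r)) = c r := by
  have : ∀ k r, R ≤ r + k → dualCarry ρ' μ' ν' m (max (μ r) (ν r)) = c r := by
    intro k
    induction k with
    | zero =>
      intro r hr
      obtain ⟨h1, h2, h3⟩ := hR r hr
      rw [h1, h2, h3]
      rfl
    | succ k ih =>
      intro r hr
      exact dualCarry_max hρ hμ hν hρμ hρν hl (ih (r + 1) (by omega))
  exact this R r (by omega)

/-- On conjugate partitions, the rule for vertical strips is the step described by `BurgeStep`. -/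
theorem areConjugate_dualRule (hl : BurgeStep ρ μ ν l c)
    (hR : ∀ r, R ≤ r → c r = m ∧ μ r = 0 ∧ ν r = 0) :
    AreConjugate (dualRule ρ' μ' ν' m) l := by
  have hd := dualCarry_max_eq hρ hμ hν hρμ hρν hl hR
  have hM : ∀ r, max (μ (r + 1)) (ν (r + 1)) ≤ ρ r ∧ ρ r ≤ max (μ r) (ν r) := fun r =>
    ⟨max_le (hρμ.succ_le r) (hρν.succ_le r), (hρμ.le r).trans (le_max_left _ _)⟩
  have hMa : Antitone fun r => max (μ r) (ν r) :=
    antitone_nat_of_succ_le fun r => (hM r).1.trans (hM r).2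
  have hlM : ∀ r, max (μ r) (ν r) ≤ l r := by
    rintro (_ | r)
    · have := hl.zero; omega
    · have := hl.succ r; omega
  have hll : ∀ q r, r + 1 ≤ q → l (q + 1) ≤ max (μ (r + 1)) (ν (r + 1)) := fun q r hq =>
    (hl.le_prev hρμ hρν q).trans ((hM q).2.trans (hMa hq))
  intro i q
  -- To the right of all three diagrams the remaining carry `c 0` lengthens the top row, one cell
  -- per column.
  by_cases h0 : max (μ 0) (ν 0) ≤ i
  · have hz : ρ' i = 0 ∧ μ' i = 0 ∧ ν' i = 0 := by
      have := hρμ.le 0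
      refine ⟨hρ.apply_eq (by simp) (by omega), hμ.apply_eq (by simp) (by omega),
        hν.apply_eq (by simp) (by omega)⟩
    have hdi : ∀ j, max (μ 0) (ν 0) ≤ j →
        dualCarry ρ' μ' ν' m j = c 0 - (j - max (μ 0) (ν 0)) := by
      intro j hj
      induction j, hj using Nat.le_induction with
      | base => rw [hd]; omega
      | succ j hj ih =>
        have := hρμ.le 0
        rw [dualCarry_succ, ih, dualStep, hρ.apply_eq (k := 0) (by simp) (by omega),
          hμ.apply_eq (k := 0) (by simp) (by omega), hν.apply_eq (k := 0) (by simp) (by omega),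
          if_pos ⟨rfl, rfl⟩]
        omega
    rw [dualRule_apply, dualStep, hdi i h0, hz.1, hz.2.1, hz.2.2, if_pos ⟨rfl, rfl⟩]
    have e0 := hl.zero
    rcases q with _ | q
    · omega
    · have := hl.le_prev hρμ hρν q
      have := (hM q).2.trans (hMa q.zero_le)
      simp only at this
      omega
  · have hex : ∃ r, max (μ r) (ν r) ≤ i := by
      obtain ⟨-, h1, h2⟩ := hR R le_rfl
      exact ⟨R, by rw [h1, h2]; simp⟩
    classical
    -- Column `i` lies between the ends of rows `r + 1` and `r`, so only row `r + 1` can gain a cell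
    -- in it.
    obtain ⟨r, hr⟩ : ∃ r, Nat.find hex = r + 1 :=
      Nat.exists_eq_succ_of_ne_zero fun h => h0 (h ▸ Nat.find_spec hex)
    have hlo : max (μ (r + 1)) (ν (r + 1)) ≤ i := hr ▸ Nat.find_spec hex
    have hhi : i < max (μ r) (ν r) := not_le.1 (Nat.find_min hex (by omega))
    have hq1 : q ≤ r → i < l q := fun hq => hhi.trans_le ((hMa hq).trans (hlM q))
    have hq2 : r + 2 ≤ q → l q ≤ i := by
      intro hq
      obtain ⟨p, rfl⟩ : ∃ p, q = p + 1 := ⟨q - 1, by omega⟩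
      exact (hll p r (by omega)).trans hlo
    have hq3 := hl.succ r
    have hq4 : q = r + 1 → l q = l (r + 1) := fun h => by rw [h]
    rw [dualRule_apply, dualStep]
    rcases lt_or_ge i (ρ r) with hi | hi
    · obtain ⟨e1, e2, e3⟩ := conj_addable hρ hμ hν hρμ hρν hlo hi
      rw [dualCarry_addable hρ hμ hν hρμ hρν (hd (r + 1)) hlo hi.le, e1, e2, e3,
        if_pos ⟨rfl, rfl⟩]
      omega
    · have e1 := conj_base hρ hρμ hρν hi hhi
      have e2 : max (μ' i) (ν' i) = r + 1 ∧ ¬(ρ' i = μ' i ∧ μ' i = ν' i) := by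
        rw [e1]
        have a1 := conj_left hμ hρμ hi
        have a2 := conj_left hν hρν hi
        have a3 := conj_not_left hμ hρμ hρν (r := r) (i := i)
        have a4 := conj_not_left hν hρν hρμ (r := r) (i := i)
        omega
      rw [e2.1, if_neg e2.2]
      omega

end DualBurge

/-! ### Adding rows from below -/

/-- The growth diagram of the entries above row `i`. -/
def upperGrowth (e : ℕ → ℕ → ℕ) (i a b : ℕ) : ℕ → ℕ :=
  growth rskRule (fun x h => e x (h + i)) a b

theorem BurgeStep.interlaces {ρ μ ν l c : ℕ → ℕ} (hμ : Interlaces ρ μ) (hν : Interlaces ρ ν)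
    (h : BurgeStep ρ μ ν l c) : Interlaces ν l where
  le := by
    rintro (_ | r)
    · have := h.zero; omega
    · have := h.succ r; omega
  succ_le r := (h.le_prev hμ hν r).trans (hν.le r)

section Upper

variable (e : ℕ → ℕ → ℕ)

theorem upperGrowth_right (i a b : ℕ) : HStrip (upperGrowth e i a b) (upperGrowth e i (a + 1) b) :=
  isLocalRule_rskRule.growth_right _ a b

theorem upperGrowth_up (i a b : ℕ) : HStrip (upperGrowth e i a b) (upperGrowth e i a (b + 1)) :=
  isLocalRule_rskRule.growth_up _ a b

theorem upperGrowth_succ (i a b : ℕ) : upperGrowth e i (a + 1) (b + 1) =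
    rskRule (upperGrowth e i a b) (upperGrowth e i a (b + 1)) (upperGrowth e i (a + 1) b)
      (e (a + 1) (b + 1 + i)) := growth_succ _ _ _ _

theorem upperGrowth_zero (i a : ℕ) : upperGrowth e i a 0 = fun _ => 0 := growth_zero_right _ _ _

/-- Adding a row from below: the step in column `a`. -/
def RowBelow (i a b : ℕ) : Prop :=
  ∃ c R, BurgeStep (upperGrowth e (i + 1) a b) (upperGrowth e i a (b + 1))
    (upperGrowth e (i + 1) (a + 1) b) (upperGrowth e i (a + 1) (b + 1)) c ∧
    ∀ r, R ≤ r → c r = e (a + 1) (i + 1)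

theorem rowBelow_zero (i a : ℕ) : RowBelow e i a 0 := by
  refine ⟨fun _ => e (a + 1) (i + 1), 0, ⟨?_, fun r => ?_, fun r => ?_⟩, fun _ _ => rfl⟩
  · simp only [upperGrowth_succ, upperGrowth_zero, rskRule_zero, Nat.zero_add, Nat.add_comm 1 i]
  · have := (upperGrowth_up e i a 0).succ_le r
    simp only [upperGrowth_succ, upperGrowth_zero, rskRule_succ] at this ⊢
    omega
  · have := (upperGrowth_up e i a 0).succ_le r
    simp only [upperGrowth_zero] at this ⊢
    omega

/-- One cube with near corner `upperGrowth e (i + 1) a b`: `α` adds column `a + 1`, `β` a row on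
top, `γ` row `i + 1` from below. The two RSK faces share their entry because it sits in the same
box. -/
theorem rowBelow_succ {i a b : ℕ}
    (hτ : Interlaces (upperGrowth e (i + 1) a (b + 1)) (upperGrowth e i a (b + 2)))
    (hS : IsSlide (upperGrowth e (i + 1) a b) (upperGrowth e (i + 1) a (b + 1))
      (upperGrowth e i a (b + 1)) (upperGrowth e i a (b + 2)))
    (hG : RowBelow e i a b) :
    RowBelow e i a (b + 1) ∧
    IsSlide (upperGrowth e (i + 1) (a + 1) b) (upperGrowth e (i + 1) (a + 1) (b + 1))
      (upperGrowth e i (a + 1) (b + 1)) (upperGrowth e i (a + 1) (b + 2)) := by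
  obtain ⟨c, R, hc, hR⟩ := hG
  have hα := upperGrowth_right e (i + 1) a b
  have hβ := upperGrowth_up e (i + 1) a b
  have hαβ := congrFun (upperGrowth_succ e (i + 1) a b)
  have hσ := congrFun (upperGrowth_succ e i a (b + 1))
  rw [show b + 1 + 1 + i = b + 1 + (i + 1) by omega] at hσ
  obtain ⟨N₁, h1⟩ := hα.right.eq_zero
  obtain ⟨N₂, h2⟩ := hβ.right.eq_zero
  obtain ⟨N₃, h3⟩ := (upperGrowth_up e i a b).right.eq_zero
  obtain ⟨N₄, h4⟩ := (upperGrowth_up e i a (b + 1)).right.eq_zero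
  refine ⟨⟨_, R + N₁ + N₂ + N₃ + N₄,
    cube_burgeStep hα.toInterlaces hβ.toInterlaces hτ hS hc hαβ hσ, fun r hr => ?_⟩,
    cube_slide hα.toInterlaces hβ.toInterlaces hτ hS hc hαβ hσ⟩
  have e1 := h1 r (by omega)
  have e2 := h2 r (by omega)
  have e3 := h3 r (by omega)
  have e4 := h4 r (by omega)
  -- Far down every correction term vanishes, as each minimum contains a zero part of `α` or `τ`;
  -- the carry keeps its initial value, the entry.
  rw [cubeCarry, e1, e2, e3, e4, hR r (by omega)]
  simp

/-- The slide faces of column `a` and its Burge steps give the slide faces of column `a + 1`; within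
a column, the Burge steps propagate upwards from the empty label. In column 0 all labels are empty.
-/
theorem upperGrowth_below (i a b : ℕ) :
    Interlaces (upperGrowth e (i + 1) a b) (upperGrowth e i a (b + 1)) ∧
      IsSlide (upperGrowth e (i + 1) a b) (upperGrowth e (i + 1) a (b + 1))
        (upperGrowth e i a (b + 1)) (upperGrowth e i a (b + 2)) ∧ RowBelow e i a b := by
  induction a generalizing b with
  | zero =>
    have h1 : ∀ b, Interlaces (upperGrowth e (i + 1) 0 b) (upperGrowth e i 0 (b + 1)) ∧
      IsSlide (upperGrowth e (i + 1) 0 b) (upperGrowth e (i + 1) 0 (b + 1))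
        (upperGrowth e i 0 (b + 1)) (upperGrowth e i 0 (b + 2)) := fun b => by
      simp only [upperGrowth, growth_zero_left]
      exact ⟨⟨fun _ => le_rfl, fun _ => le_rfl⟩, rfl, fun _ => rfl⟩
    refine ⟨(h1 b).1, (h1 b).2, ?_⟩
    induction b with
    | zero => exact rowBelow_zero e i 0
    | succ b ihb => exact (rowBelow_succ e (h1 (b + 1)).1 (h1 b).2 ihb).1
  | succ a ih =>
    have h1 : ∀ b, Interlaces (upperGrowth e (i + 1) (a + 1) b) (upperGrowth e i (a + 1) (b + 1)) ∧
      IsSlide (upperGrowth e (i + 1) (a + 1) b) (upperGrowth e (i + 1) (a + 1) (b + 1))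
        (upperGrowth e i (a + 1) (b + 1)) (upperGrowth e i (a + 1) (b + 2)) := fun b => by
      obtain ⟨c, -, hc, -⟩ := (ih b).2.2
      exact ⟨hc.interlaces (ih b).1 (upperGrowth_right e (i + 1) a b).toInterlaces,
        (rowBelow_succ e (ih (b + 1)).1 (ih b).2.1 (ih b).2.2).2⟩
    refine ⟨(h1 b).1, (h1 b).2, ?_⟩
    induction b with
    | zero => exact rowBelow_zero e i (a + 1)
    | succ b ihb => exact (rowBelow_succ e (h1 (b + 1)).1 (h1 b).2 ihb).1

/-- Reversing the rows turns the growth diagrams of the Robinson-Schensted-Knuth correspondence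
into conjugates of growth diagrams for the rule for vertical strips. -/
theorem areConjugate_upperGrowth (n a b : ℕ) (hb : b ≤ n) :
    AreConjugate (growth dualRule (fun x h => e x (n + 1 - h)) a b) (upperGrowth e (n - b) a b) := by
  induction a generalizing b with
  | zero => rw [upperGrowth, growth_zero_left, growth_zero_left]; exact fun _ _ => by simp
  | succ a iha =>
    induction b with
    | zero => rw [upperGrowth_zero, growth_zero_right]; exact fun _ _ => by simp
    | succ b ihb =>
      obtain ⟨i, hi⟩ : ∃ i, n - (b + 1) = i := ⟨_, rfl⟩
      have hi' : n - b = i + 1 := by omega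
      have h1 := iha b (by omega)
      have h2 := iha (b + 1) hb
      have h3 := ihb (by omega)
      rw [hi'] at h1 h3
      rw [hi] at h2 ⊢
      obtain ⟨h4, -, c, R, hc, hR⟩ := upperGrowth_below e i a b
      have h5 := upperGrowth_right e (i + 1) a b
      obtain ⟨N₁, e1⟩ := h2.symm.isPart.eq_zero
      obtain ⟨N₂, e2⟩ := h5.right.eq_zero
      -- Row `b + 1` of the reversed diagram is row `i + 1` of the original, so its entry is the one
      -- that starts the Burge carry.
      rw [growth_succ, show n + 1 - (b + 1) = i + 1 by omega]
      exact areConjugate_dualRule h1 h2 h3 h4 h5.toInterlaces hc (R := R + N₁ + N₂) fun r hr =>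
        ⟨hR r (by omega), e1 r (by omega), e2 r (by omega)⟩

end Upper

/-! ### Symmetric squares -/

/-- By symmetry of the entries the right side repeats the labels of the top side, and two sides
suffice to invert the square. -/
theorem rsk_square_inj {n : ℕ} {e e' : ℕ → ℕ → ℕ}
    (he : ∀ i j, i < n → j < n → e (i + 1) (j + 1) = e (j + 1) (i + 1))
    (he' : ∀ i j, i < n → j < n → e' (i + 1) (j + 1) = e' (j + 1) (i + 1))
    (h : ∀ a, a ≤ n → growth rskRule e a n = growth rskRule e' a n) :
    ∀ i j, i < n → j < n → e (i + 1) (j + 1) = e' (i + 1) (j + 1) := by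
  refine isLocalRule_rskRule.square_inj h fun b hb => ?_
  rw [isLocalRule_rskRule.growth_transpose (e' := e) fun i j hi hj => he i j hi (by omega),
    isLocalRule_rskRule.growth_transpose (e := e') (e' := e') fun i j hi hj =>
      he' i j hi (by omega), h b hb]

theorem rskRule_zero_entry {α β : ℕ → ℕ} (h : ∀ i, α i ≤ β i) : rskRule α α β 0 = β := by
  funext i
  rcases i with _ | i
  · have := h 0
    rw [rskRule_zero]
    omega
  · have := h i
    have := h (i + 1)
    rw [rskRule_succ]
    omega

theorem HStrip.refl {α : ℕ → ℕ} (h : IsPart α) : HStrip α α :=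
  ⟨⟨fun _ => le_rfl, fun i => h.anti i.le_succ⟩, h, h⟩

/-- The chain is spread along a staircase border whose vertical steps are all trivial. Above the
square the labels then depend on the column alone, so the chain reappears on the top side. -/
theorem rsk_square_surj {n : ℕ} (P : ℕ → ℕ → ℕ) (h0 : P 0 = fun _ => 0)
    (hP : ∀ a, a < n → HStrip (P a) (P (a + 1))) :
    ∃ e : ℕ → ℕ → ℕ, (∀ i j, i < n → j < n → e (i + 1) (j + 1) = e (j + 1) (i + 1)) ∧
      ∀ a, a ≤ n → growth rskRule e a n = P a := by
  obtain ⟨e, he, hb⟩ := isLocalRule_rskRule.border_surj (n := n) (fun k => P ((k + 1) / 2))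
    (by rw [Nat.zero_add, Nat.div_eq_of_lt one_lt_two, h0])
    (fun k hk => by
      rw [show (2 * k + 1) / 2 = k by omega, show (2 * k + 1 + 1) / 2 = k + 1 by omega]
      exact hP k hk)
    (fun k hk => by
      rw [show (2 * k + 2 + 1) / 2 = k + 1 by omega, show (2 * k + 1 + 1) / 2 = k + 1 by omega]
      exact .refl (hP k (by omega)).right)
  refine ⟨e, fun i j hi hj => he i j (by omega), ?_⟩
  -- Downward from the border: a box with labels `P a`, `P (a + 1)`, `P (a + 1)` at its top-left,
  -- bottom-right and top-right corners has the inverse `P a` with entry `0`, by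
  -- `rskRule_zero_entry`.
  have key : ∀ k a b, n ≤ b → a + b ≤ 2 * n → 2 * n ≤ a + b + k + 1 →
      growth rskRule e a b = P a := by
    intro k
    induction k with
    | zero =>
      intro a b h1 h2 h3
      rcases a with _ | a
      · rw [growth_zero_left, h0]
      by_cases h4 : a + 1 + b = 2 * n
      · have := hb (2 * a + 1) (by omega)
        rwa [show (2 * a + 1 + 1) / 2 = a + 1 by omega,
          show 2 * n - 1 - (2 * a + 1) / 2 = b by omega] at this
      · have := hb (2 * (a + 1)) (by omega)
        rwa [show (2 * (a + 1) + 1) / 2 = a + 1 by omega,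
          show 2 * n - 1 - 2 * (a + 1) / 2 = b by omega] at this
    | succ k ih =>
      intro a b h1 h2 h3
      by_cases h4 : 2 * n ≤ a + b + k + 1
      · exact ih a b h1 h2 h4
      have hs := hP a (by omega)
      have e1 := ih (a + 1) b h1 (by omega) (by omega)
      have e2 := ih a (b + 1) (by omega) (by omega) (by omega)
      have e3 := ih (a + 1) (b + 1) (by omega) (by omega) (by omega)
      have g1 := isLocalRule_rskRule.growth_up e a b
      have g2 := isLocalRule_rskRule.growth_right e a b
      rw [growth_succ, e1, e2] at e3
      rw [e2] at g1
      rw [e1] at g2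
      exact (isLocalRule_rskRule.inj g1 g2 (.refl hs.left) hs
        (e3.trans (rskRule_zero_entry hs.le).symm)).1
  exact fun a ha => key n a n le_rfl (by omega) (by omega)

theorem areConjugate_growth (e : ℕ → ℕ → ℕ) (n a : ℕ) :
    AreConjugate (growth dualRule (fun x h => e x (n + 1 - h)) a n) (growth rskRule e a n) := by
  have := areConjugate_upperGrowth e n a n le_rfl
  rwa [Nat.sub_self] at this

theorem dual_square_inj {n : ℕ} {e e' : ℕ → ℕ → ℕ}
    (he : ∀ i j, i < n → j < n → e (i + 1) (n - j) = e (j + 1) (n - i))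
    (he' : ∀ i j, i < n → j < n → e' (i + 1) (n - j) = e' (j + 1) (n - i))
    (h : ∀ a, a ≤ n → growth dualRule e a n = growth dualRule e' a n) :
    ∀ i j, i < n → j < n → e (i + 1) (j + 1) = e' (i + 1) (j + 1) := by
  have hflip : ∀ (e : ℕ → ℕ → ℕ) a, AreConjugate (growth dualRule e a n)
      (growth rskRule (fun x h => e x (n + 1 - h)) a n) := by
    intro e a
    have := areConjugate_growth (fun x h => e x (n + 1 - h)) n a
    rwa [growth_congr (e' := e) fun i j _ hj => by
      rw [show n + 1 - (n + 1 - (j + 1)) = j + 1 by omega]] at this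
  have key := rsk_square_inj (n := n) (e := fun x h => e x (n + 1 - h))
    (e' := fun x h => e' x (n + 1 - h)) (fun i j hi hj => by
      simpa only [Nat.add_sub_add_right] using he i j hi hj)
    (fun i j hi hj => by simpa only [Nat.add_sub_add_right] using he' i j hi hj)
    fun a ha => (hflip e a).right_unique (h a ha ▸ hflip e' a)
  intro i j hi hj
  have := key i (n - 1 - j) hi (by omega)
  rwa [show n + 1 - (n - 1 - j + 1) = j + 1 by omega] at this

/-- Conjugation turns the vertical strips into horizontal ones; reversing the rows of the symmetric
RSK square gives the antidiagonally symmetric square. -/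
theorem dual_square_surj {n : ℕ} (Q : ℕ → ℕ → ℕ) (h0 : Q 0 = fun _ => 0)
    (hQ : ∀ a, VStrip (Q a) (Q (a + 1))) :
    ∃ e : ℕ → ℕ → ℕ, (∀ i j, i < n → j < n → e (i + 1) (n - j) = e (j + 1) (n - i)) ∧
      ∀ a, a ≤ n → growth dualRule e a n = Q a := by
  choose P hP using fun a => (hQ a).left.exists_areConjugate
  obtain ⟨e, he, hb⟩ := rsk_square_surj (n := n) P
    ((hP 0).right_unique fun _ _ => by simp [h0]) fun a _ => (hP a).hStrip (hP (a + 1)) (hQ a)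
  refine ⟨fun x h => e x (n + 1 - h), fun i j hi hj => ?_, fun a ha => ?_⟩
  · change e (i + 1) (n + 1 - (n - j)) = e (j + 1) (n + 1 - (n - i))
    rw [show n + 1 - (n - j) = j + 1 by omega, show n + 1 - (n - i) = i + 1 by omega, he i j hi hj]
  · exact (areConjugate_growth e n a).left_unique (hb a ha ▸ hP a)

/-! ### Fillings -/

section Filling

variable {n : ℕ}

theorem mem_polyomino {i h : ℕ} :
    (i, h) ∈ polyomino n ↔ 1 ≤ i ∧ i ≤ n ∧ 1 ≤ h ∧ i + h ≤ 2 * n := by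
  simp only [polyomino, Finset.mem_filter, Finset.mem_product, Finset.mem_Icc]
  omega

theorem Filling.entry_of_mem (f : Filling n) (c : {c : ℕ × ℕ // c ∈ polyomino n}) :
    f.entry c.1.1 c.1.2 = f c := dif_pos c.2

theorem Filling.growth_ofEntries {R} (e : ℕ → ℕ → ℕ) {a b : ℕ} (ha : a ≤ n)
    (hab : a + b ≤ 2 * n) :
    growth R (Filling.entry (n := n) fun c => e c.1.1 c.1.2) a b = growth R e a b :=
  growth_congr fun i j _ _ => dif_pos (mem_polyomino.2 (by omega))

theorem Filling.borderLabel_ofEntries {R} (e : ℕ → ℕ → ℕ) {k : ℕ} (hk : k < 2 * n) :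
    borderLabel R (n := n) (fun c => e c.1.1 c.1.2) k =
      growth R e ((k + 1) / 2) (2 * n - 1 - k / 2) :=
  Filling.growth_ofEntries e (by omega) (by omega)

theorem IsNestingSymmetric.entry {f : Filling n} (hf : IsNestingSymmetric f) {i j : ℕ}
    (hi : i < n) (hj : j < n) : f.entry (i + 1) (j + 1) = f.entry (j + 1) (i + 1) := by
  have h1 : (i + 1, j + 1) ∈ polyomino n := mem_polyomino.2 (by omega)
  have h2 : (j + 1, i + 1) ∈ polyomino n := mem_polyomino.2 (by omega)
  rw [f.entry_of_mem ⟨_, h1⟩, f.entry_of_mem ⟨_, h2⟩]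
  exact hf ⟨_, h2⟩ ⟨_, h1⟩ hi rfl rfl

theorem IsCrossingSymmetric.entry {f : Filling n} (hf : IsCrossingSymmetric f) {i j : ℕ}
    (hi : i < n) (hj : j < n) : f.entry (i + 1) (n - j) = f.entry (j + 1) (n - i) := by
  have h1 : (i + 1, n - j) ∈ polyomino n := mem_polyomino.2 (by omega)
  have h2 : (j + 1, n - i) ∈ polyomino n := mem_polyomino.2 (by omega)
  rw [f.entry_of_mem ⟨_, h1⟩, f.entry_of_mem ⟨_, h2⟩]
  refine hf ⟨_, h2⟩ ⟨_, h1⟩ ?_ ?_ ?_ <;> simp only <;> omega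

variable {R : (ℕ → ℕ) → (ℕ → ℕ) → (ℕ → ℕ) → ℕ → ℕ → ℕ} {V : (ℕ → ℕ) → (ℕ → ℕ) → Prop}

/-- Fillings agree if they have the same border labels and the border labels determine the
entries of the square. -/
theorem IsLocalRule.filling_inj (h : IsLocalRule R V) {f g : Filling n}
    (hfg : ∀ k, k < 2 * n → borderLabel R f k = borderLabel R g k)
    (hsq : (∀ a, a ≤ n → growth R f.entry a n = growth R g.entry a n) →
      ∀ i j, i < n → j < n → f.entry (i + 1) (j + 1) = g.entry (i + 1) (j + 1)) : f = g := by
  rcases Nat.eq_zero_or_pos n with rfl | hn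
  · funext c
    have := mem_polyomino.1 c.2
    omega
  -- With `l = n`, the two antidiagonals contain only points of the upper border and of the left
  -- edge.
  have key := h.staircase_inj (e := f.entry) (e' := g.entry) (l := n) (N := 2 * n - 1) (by
    intro a b hb hab
    rcases a with _ | a
    · rw [growth_zero_left, growth_zero_left]
    · by_cases h4 : a + 1 + b = 2 * n
      · have := hfg (2 * a + 1) (by omega)
        rwa [borderLabel, borderLabel, show (2 * a + 1 + 1) / 2 = a + 1 by omega,
          show 2 * n - 1 - (2 * a + 1) / 2 = b by omega] at this
      · have := hfg (2 * (a + 1)) (by omega)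
        rwa [borderLabel, borderLabel, show (2 * (a + 1) + 1) / 2 = a + 1 by omega,
          show 2 * n - 1 - 2 * (a + 1) / 2 = b by omega] at this)
  have hsq := hsq fun a ha => (key a n le_rfl (by omega)).1
  funext c
  obtain ⟨⟨i, j⟩, hc⟩ := c
  obtain ⟨h1, h2, h3, h4⟩ := mem_polyomino.1 hc
  rw [← f.entry_of_mem ⟨_, hc⟩, ← g.entry_of_mem ⟨_, hc⟩]
  obtain ⟨i, rfl⟩ : ∃ i', i = i' + 1 := ⟨i - 1, by omega⟩
  obtain ⟨j, rfl⟩ : ∃ j', j = j' + 1 := ⟨j - 1, by omega⟩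
  rcases lt_or_ge j n with hj | hj
  · exact hsq i j h2 hj
  · exact (key i j hj (by omega)).2 (by omega)

/-- The conditions on the border labels of a filling. -/
structure IsStripChain (V : (ℕ → ℕ) → (ℕ → ℕ) → Prop) (n : ℕ) (s : ℕ → ℕ → ℕ) : Prop where
  zero : s 0 = fun _ => 0
  up : ∀ k, k < n → V (s (2 * k)) (s (2 * k + 1))
  down : ∀ k, k + 1 < n → V (s (2 * k + 2)) (s (2 * k + 1))

theorem nesting_inj {f g : Filling n} (hf : IsNestingSymmetric f) (hg : IsNestingSymmetric g)
    (hfg : ∀ k, k < 2 * n → borderLabel rskRule f k = borderLabel rskRule g k) : f = g :=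
  isLocalRule_rskRule.filling_inj hfg (rsk_square_inj (fun _ _ => hf.entry) fun _ _ => hg.entry)

theorem crossing_inj {f g : Filling n} (hf : IsCrossingSymmetric f) (hg : IsCrossingSymmetric g)
    (hfg : ∀ k, k < 2 * n → borderLabel dualRule f k = borderLabel dualRule g k) : f = g :=
  isLocalRule_dualRule.filling_inj hfg (dual_square_inj (fun _ _ => hf.entry) fun _ _ => hg.entry)

theorem nesting_surj {s : ℕ → ℕ → ℕ} (hs : IsStripChain HStrip n s) :
    ∃ f : Filling n, IsNestingSymmetric f ∧ ∀ k, k < 2 * n → borderLabel rskRule f k = s k := by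
  obtain ⟨e, he, hb⟩ := isLocalRule_rskRule.border_surj s hs.zero hs.up hs.down
  refine ⟨fun c => e c.1.1 c.1.2, ?_, fun k hk => ?_⟩
  · rintro ⟨⟨i, j⟩, hc⟩ ⟨⟨i', j'⟩, hd⟩ h1 h2 h3
    simp only at h1 h2 h3 ⊢
    subst h2 h3
    obtain ⟨h4, h5, h6, h7⟩ := mem_polyomino.1 hc
    have := he (i' - 1) (j' - 1) (by omega)
    rwa [Nat.sub_add_cancel h6, Nat.sub_add_cancel h4] at this
  · rw [Filling.borderLabel_ofEntries e hk, hb k hk]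

/-- A filling from `border_surj` has the right labels but the wrong symmetry in the square. The
square is exchanged for an antidiagonally symmetric one with the same labels on its top side, and
the growth above does not notice. -/
theorem crossing_surj {s : ℕ → ℕ → ℕ} (hs : IsStripChain VStrip n s) :
    ∃ f : Filling n, IsCrossingSymmetric f ∧
      ∀ k, k < 2 * n → borderLabel dualRule f k = s k := by
  obtain ⟨e, -, hb⟩ := isLocalRule_dualRule.border_surj s hs.zero hs.up hs.down
  obtain ⟨e', he', hb'⟩ := dual_square_surj (n := n) (fun a => growth dualRule e a n)
    (growth_zero_left _ _ _) fun a => isLocalRule_dualRule.growth_right e a n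
  set E : ℕ → ℕ → ℕ := fun i h => if h ≤ n then e' i h else e i h with hE
  have key : ∀ a j, a ≤ n → growth dualRule E a (n + j) = growth dualRule e a (n + j) := by
    intro a j ha
    induction j generalizing a with
    | zero =>
      rw [Nat.add_zero, ← hb' a ha]
      exact growth_congr fun i j _ hj => if_pos hj
    | succ j ihj =>
      induction a with
      | zero => rw [growth_zero_left, growth_zero_left]
      | succ a iha =>
        rw [← Nat.add_assoc, growth_succ, growth_succ, ihj a (by omega), ihj (a + 1) ha,
          Nat.add_assoc n j 1, iha (by omega)]
        congr 1
        exact if_neg (by omega)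
  refine ⟨fun c => E c.1.1 c.1.2, ?_, fun k hk => ?_⟩
  · rintro ⟨⟨i, j⟩, hc⟩ ⟨⟨i', j'⟩, hd⟩ h1 h2 h3
    simp only at h1 h2 h3
    obtain ⟨h4, h5, h6, h7⟩ := mem_polyomino.1 hc
    have := he' (i' - 1) (i - 1) (by omega) (by omega)
    simp only [hE]
    rw [if_pos h1, if_pos (by omega)]
    rwa [show i' - 1 + 1 = i' by omega, show i - 1 + 1 = i by omega,
      show n - (i - 1) = j' by omega, show n - (i' - 1) = j by omega] at this
  · rw [Filling.borderLabel_ofEntries E hk, ← hb k hk]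
    obtain ⟨j, hj⟩ := Nat.exists_eq_add_of_le (show n ≤ 2 * n - 1 - k / 2 by omega)
    rw [hj]
    exact key _ j (by omega)

end Filling

/-! ### Young diagrams -/

theorem YoungDiagram.ext_rowLen {α β : YoungDiagram} (h : α.rowLen = β.rowLen) : α = β := by
  ext ⟨i, j⟩
  rw [YoungDiagram.mem_cells, YoungDiagram.mem_cells, YoungDiagram.mem_iff_lt_rowLen,
    YoungDiagram.mem_iff_lt_rowLen, h]

theorem YoungDiagram.isPart_rowLen (α : YoungDiagram) : IsPart α.rowLen := by
  refine ⟨fun i j h => α.rowLen_anti i j h, α.colLen 0, ?_⟩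
  by_contra hne
  have h1 := YoungDiagram.mem_iff_lt_rowLen.2 (Nat.pos_of_ne_zero hne)
  exact lt_irrefl _ (YoungDiagram.mem_iff_lt_colLen.1 h1)

theorem IsPart.exists_rowLen {x : ℕ → ℕ} (hx : IsPart x) :
    ∃ α : YoungDiagram, α.rowLen = x := by
  obtain ⟨N, hN⟩ := hx.eq_zero
  have hmem : ∀ i j, (i, j) ∈ (Finset.range N ×ˢ Finset.range (x 0)).filter
      (fun c => c.2 < x c.1) ↔ j < x i := by
    intro i j
    have h1 := hN i
    have h2 := hx.anti i.zero_le
    simp only [Finset.mem_filter, Finset.mem_product, Finset.mem_range]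
    omega
  refine ⟨⟨(Finset.range N ×ˢ Finset.range (x 0)).filter (fun c => c.2 < x c.1), ?_⟩,
    funext fun i => eq_of_forall_lt_iff fun j => ?_⟩
  · rintro ⟨i, j⟩ ⟨i', j'⟩ hle hc
    rw [Finset.mem_coe, hmem] at hc ⊢
    exact hle.2.trans_lt (hc.trans_le (hx.anti hle.1))
  · rw [← YoungDiagram.mem_iff_lt_rowLen, ← YoungDiagram.mem_cells, hmem]

theorem YoungDiagram.le_iff_rowLen {α β : YoungDiagram} :
    α ≤ β ↔ ∀ i, α.rowLen i ≤ β.rowLen i := by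
  constructor
  · intro h i
    by_contra! hlt
    have := h (YoungDiagram.mem_iff_lt_rowLen.2 hlt)
    exact lt_irrefl _ (YoungDiagram.mem_iff_lt_rowLen.1 this)
  · rintro h ⟨i, j⟩ hc
    exact YoungDiagram.mem_iff_lt_rowLen.2 ((YoungDiagram.mem_iff_lt_rowLen.1 hc).trans_le (h i))

theorem YoungDiagram.mem_sdiff {α β : YoungDiagram} {i j : ℕ} :
    (i, j) ∈ β.cells \ α.cells ↔ j < β.rowLen i ∧ α.rowLen i ≤ j := by
  rw [Finset.mem_sdiff, YoungDiagram.mem_cells, YoungDiagram.mem_cells,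
    YoungDiagram.mem_iff_lt_rowLen, YoungDiagram.mem_iff_lt_rowLen, not_lt]

theorem addsHorizontalStrip_iff {α β : YoungDiagram} :
    AddsHorizontalStrip α β ↔ HStrip α.rowLen β.rowLen := by
  constructor
  · rintro ⟨h1, h2⟩
    refine ⟨⟨YoungDiagram.le_iff_rowLen.1 h1, fun i => ?_⟩, α.isPart_rowLen, β.isPart_rowLen⟩
    by_contra! hlt
    have h3 := α.rowLen_anti i (i + 1) i.le_succ
    have h4 := β.rowLen_anti i (i + 1) i.le_succ
    -- If interlacing fails, column `α.rowLen i` contains added cells in both rows `i` and `i + 1`.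
    have := h2 (i, α.rowLen i) (YoungDiagram.mem_sdiff.2 ⟨by omega, le_rfl⟩)
      (i + 1, α.rowLen i) (YoungDiagram.mem_sdiff.2 ⟨hlt, h3⟩) rfl
    simp at this
  · intro h
    refine ⟨YoungDiagram.le_iff_rowLen.2 h.le, ?_⟩
    rintro ⟨i, j⟩ hc ⟨i', j'⟩ hd heq
    obtain rfl : j = j' := heq
    rw [YoungDiagram.mem_sdiff] at hc hd
    have key : ∀ p q, p < q → α.rowLen p ≤ j → j < β.rowLen q → False := by
      intro p q hpq h1 h2
      have h3 := h.succ_le p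
      have h4 := β.rowLen_anti (p + 1) q hpq
      omega
    rcases lt_trichotomy i i' with hlt | rfl | hlt
    · exact (key i i' hlt hc.2 hd.1).elim
    · rfl
    · exact (key i' i hlt hd.2 hc.1).elim

theorem addsVerticalStrip_iff {α β : YoungDiagram} :
    AddsVerticalStrip α β ↔ VStrip α.rowLen β.rowLen := by
  constructor
  · rintro ⟨h1, h2⟩
    refine ⟨α.isPart_rowLen, β.isPart_rowLen, YoungDiagram.le_iff_rowLen.1 h1, fun i => ?_⟩
    by_contra! hlt
    have := h2 (i, α.rowLen i) (YoungDiagram.mem_sdiff.2 ⟨by omega, le_rfl⟩)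
      (i, α.rowLen i + 1) (YoungDiagram.mem_sdiff.2 ⟨hlt, by omega⟩) rfl
    simp at this
  · intro h
    refine ⟨YoungDiagram.le_iff_rowLen.2 h.le, ?_⟩
    rintro ⟨i, j⟩ hc ⟨i', j'⟩ hd heq
    obtain rfl : i = i' := heq
    rw [YoungDiagram.mem_sdiff] at hc hd
    have := h.le_succ i
    rw [Prod.mk.injEq]
    omega

/-! ### The bijections -/

section Equiv

variable {n : ℕ} {R : (ℕ → ℕ) → (ℕ → ℕ) → (ℕ → ℕ) → ℕ → ℕ → ℕ}
  {V : (ℕ → ℕ) → (ℕ → ℕ) → Prop} {adds : YoungDiagram → YoungDiagram → Prop}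

theorem IsLocalRule.isStripChain_borderLabel (h : IsLocalRule R V) (f : Filling n) :
    IsStripChain V n (borderLabel R f) := by
  refine ⟨growth_zero_left _ _ _, fun k hk => ?_, fun k hk => ?_⟩
  · rw [borderLabel, borderLabel, show (2 * k + 1 + 1) / 2 = k + 1 by omega,
      show (2 * k + 1) / 2 = k by omega, show 2 * k / 2 = k by omega]
    exact h.growth_right _ _ _
  · rw [borderLabel, borderLabel, show (2 * k + 1 + 1) / 2 = k + 1 by omega,
      show (2 * k + 2 + 1) / 2 = k + 1 by omega,
      show 2 * n - 1 - (2 * k + 1) / 2 = 2 * n - 1 - (k + 1) + 1 by omega]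
    exact h.growth_up _ _ _

theorem YoungDiagram.rowLen_bot (i : ℕ) : (⊥ : YoungDiagram).rowLen i = 0 := by
  by_contra hne
  exact YoungDiagram.notMem_bot _ (YoungDiagram.mem_iff_lt_rowLen.2 (Nat.pos_of_ne_zero hne))

theorem isStripSequence_of_isStripChain
    (hV : ∀ α β : YoungDiagram, adds α β ↔ V α.rowLen β.rowLen) {s : Fin (2 * n) → YoungDiagram}
    {t : ℕ → ℕ → ℕ} (ht : IsStripChain V n t) (hst : ∀ k, (s k).rowLen = t k.val) :
    IsStripSequence adds s := by
  refine ⟨fun a ha => YoungDiagram.ext_rowLen ?_, ?_⟩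
  · rw [hst, ha, ht.zero]
    exact funext fun i => (YoungDiagram.rowLen_bot i).symm
  · rintro ⟨a, ha⟩ ⟨b, hb⟩ heven hab
    -- The case of equal diagrams is covered by the empty strip.
    right
    rw [hV, hst, hst]
    simp only at heven hab ⊢
    obtain ⟨k, rfl⟩ := heven.two_dvd
    rcases hab with hab | rfl
    · obtain ⟨j, rfl⟩ : ∃ j, k = j + 1 := ⟨k - 1, by omega⟩
      obtain rfl : b = 2 * j + 1 := by omega
      exact ht.down j (by omega)
    · exact ht.up k (by omega)

theorem isStripChain_of_isStripSequence
    (hV : ∀ α β : YoungDiagram, adds α β ↔ V α.rowLen β.rowLen)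
    (hrefl : ∀ α : YoungDiagram, V α.rowLen α.rowLen) {s : Fin (2 * n) → YoungDiagram}
    (hs : IsStripSequence adds s) :
    IsStripChain V n fun k => if hk : k < 2 * n then (s ⟨k, hk⟩).rowLen else fun _ => 0 := by
  have key : ∀ a b : Fin (2 * n), Even a.val → (b.val + 1 = a.val ∨ b.val = a.val + 1) →
      V (s a).rowLen (s b).rowLen := by
    intro a b h1 h2
    rcases hs.2 a b h1 h2 with h | h
    · rw [h]; exact hrefl _
    · exact (hV _ _).1 h
  refine ⟨?_, fun k hk => ?_, fun k hk => ?_⟩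
  · split_ifs with h0
    · rw [hs.1 _ rfl]
      exact funext YoungDiagram.rowLen_bot
    · rfl
  · rw [dif_pos (by omega), dif_pos (by omega)]
    exact key _ _ (even_two_mul k) (.inr rfl)
  · rw [dif_pos (by omega), dif_pos (by omega)]
    exact key _ _ (even_two_mul (k + 1)) (.inl rfl)

theorem IsLocalRule.exists_equiv (h : IsLocalRule R V) (hpart : ∀ {α β}, V α β → IsPart α)
    (hV : ∀ α β : YoungDiagram, adds α β ↔ V α.rowLen β.rowLen)
    (hrefl : ∀ α : YoungDiagram, V α.rowLen α.rowLen) {P : Filling n → Prop}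
    (hinj : ∀ {f g : Filling n}, P f → P g →
      (∀ k, k < 2 * n → borderLabel R f k = borderLabel R g k) → f = g)
    (hsurj : ∀ {s}, IsStripChain V n s →
      ∃ f : Filling n, P f ∧ ∀ k, k < 2 * n → borderLabel R f k = s k) :
    ∃ Φ : {f : Filling n // P f} ≃ {s : Fin (2 * n) → YoungDiagram // IsStripSequence adds s},
      ∀ f k i, ((Φ f).1 k).rowLen i = borderLabel R f.1 k.val i := by
  choose D hD using fun (f : Filling n) (k : Fin (2 * n)) =>
    (show IsPart (borderLabel R f k.val) from hpart (h.growth_up _ _ _)).exists_rowLen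
  let Φ : {f : Filling n // P f} → {s : Fin (2 * n) → YoungDiagram // IsStripSequence adds s} :=
    fun f => ⟨D f.1, isStripSequence_of_isStripChain hV (h.isStripChain_borderLabel f.1) (hD f.1)⟩
  have hΦ : Function.Bijective Φ := by
    constructor
    · intro f g hfg
      refine Subtype.ext (hinj f.2 g.2 fun k hk => ?_)
      have h1 : D f.1 = D g.1 := congrArg Subtype.val hfg
      have h2 := hD f.1 ⟨k, hk⟩
      rw [h1, hD g.1] at h2
      exact h2.symm
    · rintro ⟨s, hs⟩
      obtain ⟨f, hf, hb⟩ := hsurj (isStripChain_of_isStripSequence hV hrefl hs)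
      refine ⟨⟨f, hf⟩, Subtype.ext (funext fun k => YoungDiagram.ext_rowLen ?_)⟩
      exact (hD f k).trans ((hb k k.2).trans (dif_pos k.2))
  exact ⟨Equiv.ofBijective Φ hΦ, fun f k i => congrFun (hD f.1 k) i⟩

end Equiv

theorem mainTheorem11 (n : ℕ) :
    (∃ Φ : {f : Filling n // IsNestingSymmetric f} ≃
        {s : Fin (2 * n) → YoungDiagram // IsStripSequence AddsHorizontalStrip s},
      ∀ f k i, ((Φ f).1 k).rowLen i = borderLabel rskRule f.1 k.val i) ∧
    (∃ Φ : {f : Filling n // IsCrossingSymmetric f} ≃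
        {s : Fin (2 * n) → YoungDiagram // IsStripSequence AddsVerticalStrip s},
      ∀ f k i, ((Φ f).1 k).rowLen i = borderLabel dualRule f.1 k.val i) :=
  ⟨isLocalRule_rskRule.exists_equiv HStrip.left (fun _ _ => addsHorizontalStrip_iff)
      (fun α => .refl α.isPart_rowLen) nesting_inj nesting_surj,
    isLocalRule_dualRule.exists_equiv VStrip.left (fun _ _ => addsVerticalStrip_iff)
      (fun α => ⟨α.isPart_rowLen, α.isPart_rowLen, fun _ => le_rfl, fun _ => Nat.le_succ _⟩)
      crossing_inj crossing_surj⟩
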